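/- Consider the synchronous language with threads $$T ::= 0 \mid T;T \mid \mathsf{emit}\ s \mid \nu s\,T \mid \mathsf{thread}\ T \mid \mathsf{await}\ s \mid \mathsf{watch}\ s\ T \mid A(\vec s),$$ where signal names $s$ range over a countably infinite set and thread identifiers are defined by a finite system of recursive equations, one equation $A(\vec x)=T$ for each identifier, in which the signal names free in $T$ are among $\vec x$. A program is a finite non-empty multiset of threads together with such a system. Fix sets $\mathit{Input}$ and $\mathit{Output}$ of signal names such that infinitely many signal names lie outside $\mathit{Input}\cup\mathit{Output}$. An environment is a partial function from signal names to $\{\mathsf{true},\mathsf{false}\}$. An instant $P\xrightarrow{I/O}P'$ of $P$ with input $I\subseteq\mathit{Input}$ starts in the environment in which the signals in $I$ are true, the other signals that belong to $\mathit{Input}\cup\mathit{Output}$ or are free in $P$ are false, and all others are undefined. The threads are then reduced in an arbitrary interleaving: $0;T$ becomes $T$; $\mathsf{emit}\ s$ sets $s$ to true and becomes $0$; $\nu s\,T$ takes for $s$ a name on which the environment is undefined, sets it to false and becomes $T$; $\mathsf{thread}\ T$ adds $T$ to the multiset and becomes $0$; $\mathsf{await}\ s$ becomes $0$ provided $s$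 is true; $\mathsf{watch}\ s\ 0$ becomes $0$; $A(\vec s)$ is unfolded; and reduction is allowed in $T$ inside $T;T'$ and $\mathsf{watch}\ s\ T$. When no thread can be reduced, the instant ends: $O$ is the set of signals in $\mathit{Output}$ that are then true, and $P'$ is obtained by replacing with $0$ every $\mathsf{watch}\ s\ T$ in evaluation position whose signal $s$ is true. A program is reactive if it belongs to the largest set $\mathcal R$ of programs such that for all $P\in\mathcal R$ and $I\subseteq \mathit{Input}$ there are $O$ and $P'\in\mathcal R$ with $P\xrightarrow{I/O}P'$. A run is a sequence $P\xrightarrow{I_1/O_1}P_1\xrightarrow{I_2/O_2}\cdots$; it is complete if it is infinite, or finite and not extendable; it emits on $s$ if $s\in O_n$ for some $n$. A deterministic 2-counter machine has finitely many states, at most one instruction per state, and an initial state with initial contents of its two counters. The instructions are: increment a counter and go to $q'$; decrement a non-zero counter and go to $q'$ (not applicable if the counter is zero); go to $q'$ if a counter is zero and to $q''$ otherwise. Its computation terminates if it reaches a configuration without successor. Theorem. Let $s\in\mathit{Output}\setminus\mathit{Input}$. There is a computable function that maps every deterministic 2-counter machine $M$ to a reactive program $P_M$ of the above language (signal generation $\nu$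 being allowed) that eventually emits on $s$ if and only if the computation of $M$ terminates. More precisely, if the computation of $M$ terminates then every complete run of $P_M$, for whatever inputs, emits on $s$; and if it does not terminate then no run of $P_M$ emits on $s$. -/

import Mathlib

/-! ### Deterministic 2-counter machines -/

namespace CounterMachine

/-- Instructions of a 2-counter machine; `q`, `q'` are the target states.
`inc c q` increments counter `c`; `dec c q` decrements counter `c` and is applicable only when the
counter is not zero; `test c q q'` goes to `q` if counter `c` is zero and to `q'` otherwise. -/
inductive Instr where
  | inc (c : Fin 2) (q : ℕ)
  | dec (c : Fin 2) (q : ℕ)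
  | test (c : Fin 2) (q q' : ℕ)

/-- A deterministic 2-counter machine. The states are natural numbers; the instruction of state `q`
is the `q`-th entry of the finite list `code`, and a state outside the list carries no instruction.
The initial configuration consists of `start` and the counter contents `init`. -/
structure Machine where
  code : List Instr
  start : ℕ
  init : Fin 2 → ℕ

structure Config where
  state : ℕ
  cnt : Fin 2 → ℕ

/-- The effect of an instruction on the counters, `none` if it is not applicable. -/
def Instr.exec : Instr → (Fin 2 → ℕ) → Option Config
  | .inc c q, v => some ⟨q, Function.update v c (v c + 1)⟩
  | .dec c q, v => if v c = 0 then none else some ⟨q, Function.update v c (v c - 1)⟩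
  | .test c q q', v => some ⟨if v c = 0 then q else q', v⟩

/-- The (partial) transition function. -/
def Machine.next (M : Machine) (k : Config) : Option Config :=
  match M.code[k.state]? with
  | none => none
  | some i => i.exec k.cnt

def Machine.initial (M : Machine) : Config := ⟨M.start, M.init⟩

/-- The computation of `M` is finite: from the initial configuration, a configuration is reached
that has no successor. -/
def Machine.Terminates (M : Machine) : Prop :=
  ∃ k, Relation.ReflTransGen (fun k k' => M.next k = some k') M.initial k ∧ M.next k = none

/-- Codings of instructions and machines, used to speak of computable functions on machines. -/
def Instr.equivSum : Instr ≃ (Fin 2 × ℕ) ⊕ (Fin 2 × ℕ) ⊕ (Fin 2 × ℕ × ℕ) where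
  toFun
    | .inc c q => .inl (c, q)
    | .dec c q => .inr (.inl (c, q))
    | .test c q q' => .inr (.inr (c, q, q'))
  invFun
    | .inl (c, q) => .inc c q
    | .inr (.inl (c, q)) => .dec c q
    | .inr (.inr (c, q, q')) => .test c q q'
  left_inv i := by cases i <;> rfl
  right_inv x := by rcases x with _ | _ | _ <;> rfl

instance : Primcodable Instr := Primcodable.ofEquiv _ Instr.equivSum

def Machine.equivProd : Machine ≃ List Instr × ℕ × (Fin 2 → ℕ) where
  toFun M := (M.code, M.start, M.init)
  invFun x := ⟨x.1, x.2.1, x.2.2⟩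
  left_inv _ := rfl
  right_inv _ := rfl

instance : Primcodable Machine := Primcodable.ofEquiv _ Machine.equivProd

end CounterMachine

/-! ### The synchronous language -/

namespace SL

/-- An occurrence of a signal name in a thread: a signal `sig s` (signal names are natural
numbers) or a bound name `var i` in de Bruijn notation. Terms up to renaming of bound names are thus
represented by unique terms. -/
inductive Name where
  | sig (s : ℕ)
  | var (i : ℕ)

/-- Threads. `nu T` is `ν s T`, where `var 0` in `T` stands for the bound `s`; `call A xs` is
`A(xs)`, the identifier `A` being a natural number. -/
inductive Thread where
  | nil
  | seq (T T' : Thread)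
  | emit (x : Name)
  | nu (T : Thread)
  | thread (T : Thread)
  | await (x : Name)
  | watch (x : Name) (T : Thread)
  | call (A : ℕ) (xs : List Name)

/-- An equation `A(x₀, …, xₙ₋₁) = T`: `arity` is `n`, and `var i` stands for `xᵢ` in `body`. -/
structure Equation where
  arity : ℕ
  body : Thread

/-- A program together with the finite system of equations that defines its thread identifiers:
the identifier `A` is defined by the `A`-th equation. -/
structure Program where
  eqs : List Equation
  threads : List Thread

/-- Instantiate the names `var k, …, var (k + σ.length - 1)` by the signals in `σ`. -/
def Name.inst (k : ℕ) (σ : List ℕ) : Name → Name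
  | .sig s => .sig s
  | .var i =>
    if i < k then .var i
    else match σ[i - k]? with
      | some s => .sig s
      | none => .var (i - σ.length)

/-- Instantiate the names `var k, …, var (k + σ.length - 1)` by the signals in `σ`, where `k` is the
number of binders crossed. -/
def Thread.inst (k : ℕ) (σ : List ℕ) : Thread → Thread
  | .nil => .nil
  | .seq T T' => .seq (T.inst k σ) (T'.inst k σ)
  | .emit x => .emit (x.inst k σ)
  | .nu T => .nu (T.inst (k + 1) σ)
  | .thread T => .thread (T.inst k σ)
  | .await x => .await (x.inst k σ)
  | .watch x T => .watch (x.inst k σ) (T.inst k σ)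
  | .call A xs => .call A (xs.map (Name.inst k σ))

/-- The signals occurring at a name. -/
def Name.sigs : Name → Set ℕ
  | .sig s => {s}
  | .var _ => ∅

/-- The set of signals free in a thread. -/
def Thread.sigs : Thread → Set ℕ
  | .nil => ∅
  | .seq T T' => T.sigs ∪ T'.sigs
  | .emit x => x.sigs
  | .nu T => T.sigs
  | .thread T => T.sigs
  | .await x => x.sigs
  | .watch x T => x.sigs ∪ T.sigs
  | .call _ xs => {s | ∃ x ∈ xs, s ∈ x.sigs}

/-- The set of signals free in a multiset of threads. -/
def progSigs (P : Multiset Thread) : Set ℕ := {s | ∃ T ∈ P, s ∈ T.sigs}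

/-- All de Bruijn indices at this name are less than `k`. -/
def Name.Closed (k : ℕ) : Name → Prop
  | .sig _ => True
  | .var i => i < k

/-- A well-formed thread with at most the variables `0, …, k - 1`, over a system of equations:
bound names are bound, and each call is to a defined identifier with the right number of
arguments. -/
def Thread.WF (D : List Equation) : ℕ → Thread → Prop
  | _, .nil => True
  | k, .seq T T' => T.WF D k ∧ T'.WF D k
  | k, .emit x => x.Closed k
  | k, .nu T => T.WF D (k + 1)
  | k, .thread T => T.WF D k
  | k, .await x => x.Closed k
  | k, .watch x T => x.Closed k ∧ T.WF D k
  | k, .call A xs => (∃ e, D[A]? = some e ∧ e.arity = xs.length) ∧ ∀ x ∈ xs, x.Closed k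

/-- A well-formed program: a non-empty finite multiset of threads, with equations whose right-hand
sides have no free signal names other than the parameters. -/
def Program.WF (p : Program) : Prop :=
  p.threads ≠ [] ∧ (∀ T ∈ p.threads, T.WF p.eqs 0) ∧
    ∀ e ∈ p.eqs, e.body.WF p.eqs e.arity ∧ e.body.sigs = ∅

/-- Environments: partial functions from signal names to booleans. -/
abbrev Env := ℕ → Option Bool

/-- Thread reduction: `Step D T E P T' E'` is `(T, E) →^P (T', E')`, where `P` is the multiset of
spawned threads. The last two rules close the reduction of redexes under the evaluation contexts
`C ::= [ ] | C; T | watch s C`. -/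
inductive Step (D : List Equation) : Thread → Env → Multiset Thread → Thread → Env → Prop
  | seqNil (T : Thread) (E : Env) : Step D (.seq .nil T) E 0 T E
  | emit (s : ℕ) (E : Env) :
      Step D (.emit (.sig s)) E 0 .nil (Function.update E s (some true))
  | watchNil (s : ℕ) (E : Env) : Step D (.watch (.sig s) .nil) E 0 .nil E
  | nu (T : Thread) (E : Env) (s : ℕ) (hs : E s = none) :
      Step D (.nu T) E 0 (T.inst 0 [s]) (Function.update E s (some false))
  | call (A : ℕ) (σ : List ℕ) (E : Env) (e : Equation) (he : D[A]? = some e)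
      (hσ : e.arity = σ.length) :
      Step D (.call A (σ.map Name.sig)) E 0 (e.body.inst 0 σ) E
  | await (s : ℕ) (E : Env) (hs : E s = some true) : Step D (.await (.sig s)) E 0 .nil E
  | thread (T : Thread) (E : Env) : Step D (.thread T) E {T} .nil E
  | seqCtx (T T' U : Thread) (E E' : Env) (P : Multiset Thread) (h : Step D T E P T' E') :
      Step D (.seq T U) E P (.seq T' U) E'
  | watchCtx (s : ℕ) (T T' : Thread) (E E' : Env) (P : Multiset Thread)
      (h : Step D T E P T' E') :
      Step D (.watch (.sig s) T) E P (.watch (.sig s) T') E'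

/-- A thread is suspended if it cannot be reduced. -/
def Thread.Suspended (D : List Equation) (T : Thread) (E : Env) : Prop :=
  ∀ P T' E', ¬ Step D T E P T' E'

/-- Program reduction within an instant: an arbitrary thread performs a reduction step. -/
inductive ProgStep (D : List Equation) : Multiset Thread × Env → Multiset Thread × Env → Prop
  | mk (P P'' : Multiset Thread) (T T' : Thread) (E E' : Env) (h : Step D T E P'' T' E') :
      ProgStep D (P + {T}, E) (P + {T'} + P'', E')

/-- The computation `⌊T⌋_E` at the end of an instant (only used on suspended threads). -/
def Thread.floor (E : Env) : Thread → Thread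
  | .seq T T' => .seq (T.floor E) T'
  | .watch (.sig s) T => if E s = some true then .nil else .watch (.sig s) (T.floor E)
  | T => T

/-- The observable signals; infinitely many signal names are not observable. -/
structure Interface where
  input : Set ℕ
  output : Set ℕ
  infinite_compl : (input ∪ output)ᶜ.Infinite

open Classical in
/-- The environment `E_{I,P}` at the beginning of an instant. -/
noncomputable def startEnv (J : Interface) (I : Set ℕ) (P : Multiset Thread) : Env := fun s =>
  if s ∈ I then some true
  else if s ∈ J.input ∪ J.output ∪ progSigs P then some false
  else none

/-- The transition `P →^{I/O} P'` performed in one instant. -/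
def Instant (J : Interface) (D : List Equation) (P : Multiset Thread) (I O : Set ℕ)
    (P' : Multiset Thread) : Prop :=
  I ⊆ J.input ∧ ∃ (Q : Multiset Thread) (E : Env),
    Relation.ReflTransGen (ProgStep D) (P, startEnv J I P) (Q, E) ∧
    (∀ T ∈ Q, T.Suspended D E) ∧
    O = {s | s ∈ J.output ∧ E s = some true} ∧
    P' = Q.map (Thread.floor E)

/-- Membership in the largest set `R` of programs such that every `P ∈ R` can, for every choice of
the input signals, perform an instant and lead to an element of `R`. -/
def Reactive (J : Interface) (D : List Equation) (P : Multiset Thread) : Prop :=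
  ∃ R : Set (Multiset Thread), P ∈ R ∧
    ∀ Q ∈ R, ∀ I ⊆ J.input, ∃ (O : Set ℕ) (Q' : Multiset Thread),
      Instant J D Q I O Q' ∧ Q' ∈ R

/-- Finite runs, with their words of inputs and outputs. -/
inductive Run (J : Interface) (D : List Equation) :
    Multiset Thread → List (Set ℕ × Set ℕ) → Multiset Thread → Prop
  | nil (P : Multiset Thread) : Run J D P [] P
  | cons (P P' P'' : Multiset Thread) (I O : Set ℕ) (w : List (Set ℕ × Set ℕ))
      (h : Instant J D P I O P') (h' : Run J D P' w P'') : Run J D P ((I, O) :: w) P''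

/-- Some run of the program emits on the signal `s`. -/
def MayEmit (J : Interface) (D : List Equation) (P : Multiset Thread) (s : ℕ) : Prop :=
  ∃ (w : List (Set ℕ × Set ℕ)) (P' : Multiset Thread),
    Run J D P w P' ∧ ∃ io ∈ w, s ∈ io.2

/-- Every complete run of the program, that is every run which is infinite or which is finite and
cannot be extended, emits on the signal `s`. -/
def MustEmit (J : Interface) (D : List Equation) (P : Multiset Thread) (s : ℕ) : Prop :=
  (∀ (Q : ℕ → Multiset Thread) (I O : ℕ → Set ℕ), Q 0 = P →
      (∀ n, Instant J D (Q n) (I n) (O n) (Q (n + 1))) → ∃ n, s ∈ O n) ∧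
  (∀ (w : List (Set ℕ × Set ℕ)) (P' : Multiset Thread), Run J D P w P' →
      (∀ I O P'', ¬ Instant J D P' I O P'') → ∃ io ∈ w, s ∈ io.2)

/-! Codings of names, threads and programs, used to speak of computable functions into programs. -/

def Name.equivSum : Name ≃ ℕ ⊕ ℕ where
  toFun
    | .sig s => .inl s
    | .var i => .inr i
  invFun
    | .inl s => .sig s
    | .inr i => .var i
  left_inv x := by cases x <;> rfl
  right_inv x := by cases x <;> rfl

instance : Denumerable Name := Denumerable.ofEquiv _ Name.equivSum

/-- A Gödel numbering of threads. -/
def Thread.toNat : Thread → ℕ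
  | .nil => 0
  | .seq T T' => 7 * Nat.pair T.toNat T'.toNat + 1
  | .emit x => 7 * Encodable.encode x + 1 + 1
  | .nu T => 7 * T.toNat + 2 + 1
  | .thread T => 7 * T.toNat + 3 + 1
  | .await x => 7 * Encodable.encode x + 4 + 1
  | .watch x T => 7 * Nat.pair (Encodable.encode x) T.toNat + 5 + 1
  | .call A xs => 7 * Nat.pair A (Encodable.encode xs) + 6 + 1

/-- The inverse of the numbering. -/
def Thread.ofNat : ℕ → Thread
  | 0 => .nil
  | n + 1 =>
    have h0 : n / 7 < n + 1 := by omega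
    have h1 : (n / 7).unpair.1 < n + 1 := lt_of_le_of_lt (Nat.unpair_left_le _) h0
    have h2 : (n / 7).unpair.2 < n + 1 := lt_of_le_of_lt (Nat.unpair_right_le _) h0
    match n % 7 with
    | 0 => .seq (Thread.ofNat (n / 7).unpair.1) (Thread.ofNat (n / 7).unpair.2)
    | 1 => .emit (Denumerable.ofNat Name (n / 7))
    | 2 => .nu (Thread.ofNat (n / 7))
    | 3 => .thread (Thread.ofNat (n / 7))
    | 4 => .await (Denumerable.ofNat Name (n / 7))
    | 5 => .watch (Denumerable.ofNat Name (n / 7).unpair.1) (Thread.ofNat (n / 7).unpair.2)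
    | _ => .call (n / 7).unpair.1 (Denumerable.ofNat (List Name) (n / 7).unpair.2)

theorem Thread.ofNat_toNat (T : Thread) : Thread.ofNat T.toNat = T := by
  have key : ∀ a r, r < 7 → (7 * a + r) % 7 = r ∧ (7 * a + r) / 7 = a := by
    intro a r h; omega
  induction T with
  | nil => simp [Thread.toNat, Thread.ofNat]
  | seq T T' h h' =>
    obtain ⟨e1, e2⟩ := key (Nat.pair T.toNat T'.toNat) 0 (by omega)
    rw [Nat.add_zero] at e1 e2
    simp only [Thread.toNat, Thread.ofNat, e1, e2, Nat.unpair_pair, h, h']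
  | emit x =>
    obtain ⟨e1, e2⟩ := key (Encodable.encode x) 1 (by omega)
    simp only [Thread.toNat, Thread.ofNat, e1, e2, Denumerable.ofNat_encode]
  | nu T h =>
    obtain ⟨e1, e2⟩ := key T.toNat 2 (by omega)
    simp only [Thread.toNat, Thread.ofNat, e1, e2, h]
  | thread T h =>
    obtain ⟨e1, e2⟩ := key T.toNat 3 (by omega)
    simp only [Thread.toNat, Thread.ofNat, e1, e2, h]
  | await x =>
    obtain ⟨e1, e2⟩ := key (Encodable.encode x) 4 (by omega)
    simp only [Thread.toNat, Thread.ofNat, e1, e2, Denumerable.ofNat_encode]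
  | watch x T h =>
    obtain ⟨e1, e2⟩ := key (Nat.pair (Encodable.encode x) T.toNat) 5 (by omega)
    simp only [Thread.toNat, Thread.ofNat, e1, e2, Nat.unpair_pair, Denumerable.ofNat_encode, h]
  | call A xs =>
    obtain ⟨e1, e2⟩ := key (Nat.pair A (Encodable.encode xs)) 6 (by omega)
    simp only [Thread.toNat, Thread.ofNat, e1, e2, Nat.unpair_pair, Denumerable.ofNat_encode]

theorem Thread.toNat_ofNat (n : ℕ) : (Thread.ofNat n).toNat = n := by
  induction n using Nat.strong_induction_on with
  | _ n ih =>
    cases n with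
    | zero => simp [Thread.toNat, Thread.ofNat]
    | succ n =>
      have h0 : n / 7 < n + 1 := by omega
      have i0 := ih _ h0
      have i1 := ih _ (lt_of_le_of_lt (Nat.unpair_left_le (n / 7)) h0)
      have i2 := ih _ (lt_of_le_of_lt (Nat.unpair_right_le (n / 7)) h0)
      have hr : n % 7 < 7 := Nat.mod_lt _ (by omega)
      have hd : 7 * (n / 7) + n % 7 = n := Nat.div_add_mod n 7
      rw [Thread.ofNat]
      generalize n % 7 = r at hr hd ⊢
      interval_cases r <;>
        simp only [Thread.toNat, i0, i1, i2, Denumerable.encode_ofNat, Nat.pair_unpair] <;>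
        omega

instance : Denumerable Thread :=
  Denumerable.mk' ⟨Thread.toNat, Thread.ofNat, Thread.ofNat_toNat, Thread.toNat_ofNat⟩

def Equation.equivProd : Equation ≃ ℕ × Thread where
  toFun e := (e.arity, e.body)
  invFun x := ⟨x.1, x.2⟩
  left_inv _ := rfl
  right_inv _ := rfl

instance : Primcodable Equation := Primcodable.ofEquiv _ Equation.equivProd

def Program.equivProd : Program ≃ List Equation × List Thread where
  toFun p := (p.eqs, p.threads)
  invFun x := ⟨x.1, x.2⟩
  left_inv _ := rfl
  right_inv _ := rfl

instance : Primcodable Program := Primcodable.ofEquiv _ Program.equivProd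

end SL

/-!
In every instant the program performs one step of the machine. A counter with contents `n` is a
stack of `n` frames, each waiting for a private signal that was generated when it was pushed; an
additional thread at the top knows the signal of the topmost frame and whether there is one, and
this is what it announces at the beginning of each instant. The control thread reads the status of
the counter it is interested in, sends both counters a command, and everybody waits for the next
instant; if the machine has no successor configuration, it emits the output and nobody is commanded.
Initial contents of the counters are created by additional increments.

All reductions that occur are robust: they remain possible whatever the other threads do, and
commute with every other reduction. Hence a single interleaving of the instant may be followed, and
whatever is found at its end holds at the end of every interleaving.
-/

namespace SL

/-! ### Reduction within an instant -/

/-- The interaction of a redex with the environment. -/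
inductive Label where
  | tau
  | emit (s : ℕ)
  | nu (s : ℕ)
  | await (s : ℕ)

/-- The environment allows a reduction with this label. -/
def Label.Enabled : Label → Env → Prop
  | .tau, _ => True
  | .emit _, _ => True
  | .nu s, E => E s = none
  | .await s, E => E s = some true

/-- The environment after a reduction with this label. -/
def Label.effect : Label → Env → Env
  | .tau, E => E
  | .emit s, E => Function.update E s (some true)
  | .nu s, E => Function.update E s (some false)
  | .await _, E => E

/-- Thread reduction with its dependence on the environment abstracted into a label. -/
inductive LStep (D : List Equation) : Thread → Label → Multiset Thread → Thread → Prop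
  | seqNil (T : Thread) : LStep D (.seq .nil T) .tau 0 T
  | emit (s : ℕ) : LStep D (.emit (.sig s)) (.emit s) 0 .nil
  | watchNil (s : ℕ) : LStep D (.watch (.sig s) .nil) .tau 0 .nil
  | nu (T : Thread) (s : ℕ) : LStep D (.nu T) (.nu s) 0 (T.inst 0 [s])
  | call (A : ℕ) (σ : List ℕ) (e : Equation) (he : D[A]? = some e) (hσ : e.arity = σ.length) :
      LStep D (.call A (σ.map Name.sig)) .tau 0 (e.body.inst 0 σ)
  | await (s : ℕ) : LStep D (.await (.sig s)) (.await s) 0 .nil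
  | thread (T : Thread) : LStep D (.thread T) .tau {T} .nil
  | seqCtx {T T' U : Thread} {a : Label} {P : Multiset Thread} (h : LStep D T a P T') :
      LStep D (.seq T U) a P (.seq T' U)
  | watchCtx {s : ℕ} {T T' : Thread} {a : Label} {P : Multiset Thread} (h : LStep D T a P T') :
      LStep D (.watch (.sig s) T) a P (.watch (.sig s) T')

/-- No thread of the multiset can be reduced: the instant is over. -/
def Final (D : List Equation) (c : Multiset Thread × Env) : Prop :=
  ∀ T ∈ c.1, T.Suspended D c.2

/-- Paths of reductions within an instant. -/
abbrev Steps (D : List Equation) : Multiset Thread × Env → Multiset Thread × Env → Prop :=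
  Relation.ReflTransGen (ProgStep D)

section Reduction

variable {D : List Equation} {T T₁ T₂ : Thread} {P P₁ P₂ Q R : Multiset Thread} {E F : Env}
  {a b : Label}

theorem step_iff_lstep :
    Step D T E P T₁ F ↔ ∃ a, LStep D T a P T₁ ∧ a.Enabled E ∧ F = a.effect E := by
  constructor
  · intro h
    induction h with
    | seqNil T E => exact ⟨_, .seqNil T, trivial, rfl⟩
    | emit s E => exact ⟨_, .emit s, trivial, rfl⟩
    | watchNil s E => exact ⟨_, .watchNil s, trivial, rfl⟩
    | nu T E s hs => exact ⟨_, .nu T s, hs, rfl⟩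
    | call A σ E e he hσ => exact ⟨_, .call A σ e he hσ, trivial, rfl⟩
    | await s E hs => exact ⟨_, .await s, hs, rfl⟩
    | thread T E => exact ⟨_, .thread T, trivial, rfl⟩
    | seqCtx _ _ _ _ _ _ _ ih => exact ih.imp fun _ ha => ⟨.seqCtx ha.1, ha.2⟩
    | watchCtx _ _ _ _ _ _ _ ih => exact ih.imp fun _ ha => ⟨.watchCtx ha.1, ha.2⟩
  · rintro ⟨a, h, ha, rfl⟩
    induction h with
    | seqNil T => exact .seqNil T E
    | emit s => exact .emit s E
    | watchNil s => exact .watchNil s E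
    | nu T s => exact .nu T E s ha
    | call A σ e he hσ => exact .call A σ E e he hσ
    | await s => exact .await s E ha
    | thread T => exact .thread T E
    | seqCtx _ ih => exact .seqCtx _ _ _ _ _ _ (ih ha)
    | watchCtx _ ih => exact .watchCtx _ _ _ _ _ _ (ih ha)

theorem progStep_iff :
    ProgStep D (P, E) (Q, F) ↔ ∃ T R a P₁ T₁, P = {T} + R ∧ LStep D T a P₁ T₁ ∧ a.Enabled E ∧
      Q = {T₁} + (P₁ + R) ∧ F = a.effect E := by
  constructor
  · rintro ⟨R, P₁, T, T₁, _, _, h⟩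
    obtain ⟨a, hT, ha, rfl⟩ := step_iff_lstep.1 h
    exact ⟨T, R, a, P₁, T₁, by abel, hT, ha, by abel, rfl⟩
  · rintro ⟨T, R, a, P₁, T₁, rfl, hT, ha, rfl, rfl⟩
    have := ProgStep.mk R P₁ T T₁ E _ (step_iff_lstep.2 ⟨a, hT, ha, rfl⟩)
    convert this using 2 <;> abel

theorem LStep.progStep (h : LStep D T a P T₁) (ha : a.Enabled E) (R : Multiset Thread) :
    ProgStep D ({T} + R, E) ({T₁} + (P + R), a.effect E) :=
  progStep_iff.2 ⟨T, R, a, P, T₁, rfl, h, ha, rfl, rfl⟩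

theorem LStep.not_suspended (h : LStep D T a P T₁) (ha : a.Enabled E) : ¬ T.Suspended D E :=
  fun hT => hT _ _ _ (step_iff_lstep.2 ⟨a, h, ha, rfl⟩)

theorem Final.eq_of_steps {c d : Multiset Thread × Env} (hc : Final D c) (h : Steps D c d) :
    c = d := by
  obtain rfl | ⟨⟨Q, F⟩, h, -⟩ := h.cases_head
  · rfl
  · obtain ⟨T, R, a, P₁, T₁, hP, hT, ha, -⟩ := progStep_iff.1 h
    exact absurd (hc T (by simp [hP])) (hT.not_suspended ha)

theorem sig_injective : Function.Injective Name.sig := fun _ _ => Name.sig.inj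

theorem LStep.eq_or_nu (h₁ : LStep D T a P₁ T₁) (h₂ : LStep D T b P₂ T₂) :
    (a = b ∧ P₁ = P₂ ∧ T₁ = T₂) ∨ ∃ s t, a = .nu s ∧ b = .nu t := by
  induction h₁ generalizing b P₂ T₂ with
  | seqNil T =>
    cases h₂ with
    | seqNil => simp
    | seqCtx h => cases h
  | watchNil s =>
    cases h₂ with
    | watchNil => simp
    | watchCtx h => cases h
  | call A σ e he =>
    generalize hxs : σ.map Name.sig = xs at h₂
    obtain _ | _ | _ | _ | ⟨_, σ', e', he', -⟩ := h₂
    obtain rfl := List.map_injective_iff.2 sig_injective hxs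
    obtain rfl := Option.some.inj (he.symm.trans he')
    simp
  | seqCtx h ih =>
    cases h₂ with
    | seqNil => cases h
    | seqCtx h' => exact (ih h').imp_left fun ⟨ha, hP, hT⟩ => ⟨ha, hP, hT ▸ rfl⟩
  | watchCtx h ih =>
    cases h₂ with
    | watchNil => cases h
    | watchCtx h' => exact (ih h').imp_left fun ⟨ha, hP, hT⟩ => ⟨ha, hP, hT ▸ rfl⟩
  | _ => cases h₂; simp

theorem LStep.rename_nu {s : ℕ} (h : LStep D T (.nu s) P T₁) (t : ℕ) :
    ∃ T₂, LStep D T (.nu t) P T₂ := by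
  generalize ha : Label.nu s = a at h
  induction h with
  | nu T s => exact ⟨_, .nu T t⟩
  | seqCtx _ ih => exact (ih ha).imp' _ fun _ => .seqCtx
  | watchCtx _ ih => exact (ih ha).imp' _ fun _ => .watchCtx
  | _ => cases ha

namespace Label

theorem effect_ne_none {s : ℕ} (h : E s ≠ none) : a.effect E s ≠ none := by
  cases a <;> simp only [effect, Function.update_apply] <;> try split_ifs
  all_goals simp_all

theorem effect_eq_true {s : ℕ} (ha : a.Enabled E) (h : E s = some true) :
    a.effect E s = some true := by
  cases a <;> simp only [effect, Function.update_apply] <;> try split_ifs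
  all_goals simp_all [Enabled]

theorem effect_eq_of_ne {s : ℕ} (he : a ≠ .emit s) (hn : a ≠ .nu s) : a.effect E s = E s := by
  cases a with
  | emit t => exact Function.update_of_ne (fun h => he (congrArg _ h.symm)) _ _
  | nu t => exact Function.update_of_ne (fun h => hn (congrArg _ h.symm)) _ _
  | _ => rfl

theorem infinite_effect_eq_none (h : {s | E s = none}.Infinite) :
    {s | a.effect E s = none}.Infinite := by
  have hfin : {s | a = .emit s ∨ a = .nu s}.Finite :=
    Set.Subsingleton.finite fun s hs t ht => by aesop
  refine (h.sdiff hfin).mono ?_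
  rintro s ⟨hs, hne⟩
  rw [Set.mem_ofPred_eq, not_or] at hne
  exact (effect_eq_of_ne hne.1 hne.2).trans hs

/-- A reduction with this label is possible, up to the choice of a generated signal, and remains
possible whatever the other threads do; an emission neither enables nor disables a generation. -/
def Robust : Label → Env → Prop
  | .tau, _ => True
  | .emit s, E => E s ≠ none
  | .nu _, E => {s | E s = none}.Infinite
  | .await s, E => E s = some true

theorem Robust.effect (hb : b.Robust E) (ha : a.Enabled E) : b.Robust (a.effect E) := by
  cases b with
  | tau => trivial
  | emit s => exact effect_ne_none hb
  | nu s => exact infinite_effect_eq_none hb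
  | await s => exact effect_eq_true ha hb

theorem commute (ha : a.Enabled E) (hb : b.Robust E) (hab : b.Enabled (a.effect E)) :
    b.Enabled E ∧ a.Enabled (b.effect E) ∧ a.effect (b.effect E) = b.effect (a.effect E) := by
  cases b with
  | tau => exact ⟨trivial, ha, rfl⟩
  | await s => exact ⟨hb, ha, rfl⟩
  | emit s =>
    refine ⟨trivial, ?_⟩
    cases a with
    | tau => exact ⟨trivial, rfl⟩
    | await t => exact ⟨effect_eq_true (a := .emit s) trivial ha, rfl⟩
    | emit t =>
      refine ⟨trivial, ?_⟩
      obtain rfl | hne := eq_or_ne t s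
      · rfl
      · exact Function.update_comm hne.symm _ _ _
    | nu t =>
      have hne : t ≠ s := fun h => hb (h ▸ ha)
      exact ⟨(Function.update_of_ne hne _ _).trans ha, Function.update_comm hne.symm _ _ _⟩
  | nu s =>
    have hs : E s = none := by_contra fun h => effect_ne_none h hab
    refine ⟨hs, ?_⟩
    cases a with
    | tau => exact ⟨trivial, rfl⟩
    | await t => exact ⟨effect_eq_true (a := .nu s) hs ha, rfl⟩
    | emit t =>
      have hne : t ≠ s := by rintro rfl; simp [Enabled, Label.effect] at hab
      exact ⟨trivial, Function.update_comm hne.symm _ _ _⟩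
    | nu t =>
      have hne : t ≠ s := by rintro rfl; simp [Enabled, Label.effect] at hab
      exact ⟨(Function.update_of_ne hne _ _).trans ha, Function.update_comm hne.symm _ _ _⟩

end Label

theorem LStep.exists_enabled (h : LStep D T a P T₁) (ha : a.Robust E) :
    ∃ b T₂, LStep D T b P T₂ ∧ b.Enabled E := by
  cases a with
  | tau => exact ⟨_, _, h, trivial⟩
  | emit s => exact ⟨_, _, h, trivial⟩
  | await s => exact ⟨_, _, h, ha⟩
  | nu s =>
    obtain ⟨t, ht⟩ := Set.Infinite.nonempty ha
    obtain ⟨T₂, hT⟩ := h.rename_nu t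
    exact ⟨_, _, hT, ht⟩

theorem LStep.robust_of_robust (h₁ : LStep D T a P₁ T₁) (ha : a.Robust E)
    (h₂ : LStep D T b P₂ T₂) : b.Robust E := by
  obtain ⟨rfl, -⟩ | ⟨s, t, rfl, rfl⟩ := h₁.eq_or_nu h₂ <;> exact ha

/-- A robust redex is eventually contracted on every terminating path; as it commutes with the
reductions performed before, it may be contracted at once. -/
theorem LStep.exists_steps_of_final {d : Multiset Thread × Env} (h : LStep D T a P T₁)
    (ha : a.Robust E) (hd : Final D d) (hs : Steps D ({T} + R, E) d) :
    ∃ b P₂ T₂, LStep D T b P₂ T₂ ∧ b.Enabled E ∧ Steps D ({T₂} + (P₂ + R), b.effect E) d := by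
  generalize hc : ({T} + R, E) = c at hs
  induction hs using Relation.ReflTransGen.head_induction_on generalizing R E with
  | refl =>
    subst hc
    obtain ⟨b, T₂, hT, hb⟩ := h.exists_enabled ha
    exact absurd (hd T (by simp)) (hT.not_suspended hb)
  | @head _ c₁ hstep hs ih =>
    subst hc
    obtain ⟨Q, F⟩ := c₁
    obtain ⟨U, W, b, PU, U', hR, hU, hb, rfl, rfl⟩ := progStep_iff.1 hstep
    rw [Multiset.singleton_add, Multiset.singleton_add] at hR
    obtain ⟨rfl, rfl⟩ | ⟨-, V, rfl, rfl⟩ := Multiset.cons_eq_cons.1 hR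
    · exact ⟨b, PU, U', hU, hb, hs⟩
    · obtain ⟨b', P₂, T₂, hT, hb', hd'⟩ := ih (R := {U'} + (PU + V)) (ha.effect hb) (by
        simp only [← Multiset.singleton_add]; congr 1; abel)
      obtain ⟨hb'E, hbE, hcomm⟩ := Label.commute hb (h.robust_of_robust ha hT) hb'
      refine ⟨b', P₂, T₂, hT, hb'E, .head ?_ hd'⟩
      have := hU.progStep hbE ({T₂} + (P₂ + V))
      rw [hcomm] at this
      simp only [← Multiset.singleton_add]
      convert this using 2 <;> abel

end Reduction

/-! ### Executing an instant -/

/-- Some path from `(P, E)` terminates, and every terminating path ends in a configuration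
satisfying `K`. -/
def Settles (D : List Equation) (K : Multiset Thread → Env → Prop) (P : Multiset Thread)
    (E : Env) : Prop :=
  (∃ d, Steps D (P, E) d ∧ Final D d) ∧ ∀ d, Steps D (P, E) d → Final D d → K d.1 d.2

namespace Settles

variable {D : List Equation} {K : Multiset Thread → Env → Prop} {E : Env}
  {P R : Multiset Thread} {T T₁ U : Thread} {k s t : ℕ}

theorem of_final (h : Final D (P, E)) (hK : K P E) : Settles D K P E :=
  ⟨⟨_, .refl, h⟩, fun _ hd _ => h.eq_of_steps hd ▸ hK⟩

theorem of_robust {a : Label} (h : LStep D T a P T₁) (ha : a.Robust E)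
    (hK : ∀ b P₁ T₁, LStep D T b P₁ T₁ → b.Enabled E →
      Settles D K ({T₁} + (P₁ + R)) (b.effect E)) :
    Settles D K ({T} + R) E := by
  constructor
  · obtain ⟨b, T₂, hT, hb⟩ := h.exists_enabled ha
    obtain ⟨d, hd, hF⟩ := (hK b P T₂ hT hb).1
    exact ⟨d, .head (hT.progStep hb R) hd, hF⟩
  · intro d hd hF
    obtain ⟨b, P₂, T₂, hT, hb, hd'⟩ := h.exists_steps_of_final ha hF hd
    exact (hK b P₂ T₂ hT hb).2 d hd' hF

theorem of_lstep {a : Label} (h : LStep D T a P T₁) (ha : a.Robust E) (hnu : ∀ s, a ≠ .nu s)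
    (hK : Settles D K ({T₁} + (P + R)) (a.effect E)) : Settles D K ({T} + R) E := by
  refine of_robust h ha fun b P₂ T₂ hT _ => ?_
  obtain ⟨rfl, rfl, rfl⟩ | ⟨s, -, hs, -⟩ := h.eq_or_nu hT
  · exact hK
  · exact absurd hs (hnu s)

theorem tau (h : LStep D T .tau 0 T₁) (hK : Settles D K ({T₁} + R) E) :
    Settles D K ({T} + R) E :=
  of_lstep h trivial nofun (by rwa [zero_add])

theorem spawn (h : LStep D T .tau {U} T₁) (hK : Settles D K ({T₁} + ({U} + R)) E) :
    Settles D K ({T} + R) E :=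
  of_lstep h trivial nofun hK

theorem emit (h : LStep D T (.emit s) 0 T₁) (hs : E s ≠ none)
    (hK : Settles D K ({T₁} + R) (Function.update E s (some true))) :
    Settles D K ({T} + R) E :=
  of_lstep h hs nofun (by rwa [zero_add])

theorem await (h : LStep D T (.await s) 0 T₁) (hs : E s = some true)
    (hK : Settles D K ({T₁} + R) E) : Settles D K ({T} + R) E :=
  of_lstep h hs nofun (by rwa [zero_add])

theorem nu (hE : {s | E s = none}.Infinite)
    (hK : ∀ s, E s = none → Settles D K ({T.inst 0 [s]} + R) (Function.update E s (some false))) :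
    Settles D K ({.nu T} + R) E := by
  obtain ⟨s, -⟩ := hE.nonempty
  refine of_robust (.nu T s) hE fun b P₁ T₁ hT hb => ?_
  cases hT with
  | nu _ s => simpa only [zero_add] using! hK s hb

theorem seq_emit (hs : E s ≠ none)
    (hK : Settles D K ({U} + R) (Function.update E s (some true))) :
    Settles D K ({.seq (.emit (.sig s)) U} + R) E :=
  emit (.seqCtx (.emit s)) hs (tau (.seqNil U) hK)

theorem seq_thread (hK : Settles D K ({U} + ({T} + R)) E) :
    Settles D K ({.seq (.thread T) U} + R) E :=
  spawn (.seqCtx (.thread T)) (tau (.seqNil U) hK)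

theorem seq_await (hs : E s = some true) (hK : Settles D K ({U} + R) E) :
    Settles D K ({.seq (.await (.sig s)) U} + R) E :=
  await (.seqCtx (.await s)) hs (tau (.seqNil U) hK)

theorem watch_await_thread (hs : E s = some true)
    (hK : Settles D K ({T} + ({.nil} + R)) E) :
    Settles D K ({.watch (.sig k) (.seq (.await (.sig s)) (.thread T))} + R) E :=
  await (.watchCtx (.seqCtx (.await s))) hs <| tau (.watchCtx (.seqNil _)) <|
    spawn (.watchCtx (.thread T)) <| tau (.watchNil k) <| by rwa [add_left_comm]

theorem watch_await_emit (hs : E s = some true) (ht : E t ≠ none)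
    (hK : Settles D K ({.nil} + R) (Function.update E t (some true))) :
    Settles D K ({.watch (.sig k) (.seq (.await (.sig s)) (.emit (.sig t)))} + R) E :=
  await (.watchCtx (.seqCtx (.await s))) hs <| tau (.watchCtx (.seqNil _)) <|
    emit (.watchCtx (.emit t)) ht <| tau (.watchNil k) hK

end Settles

section Suspended

variable {D : List Equation} {E : Env}

theorem suspended_nil : Thread.Suspended D .nil E := nofun

/-- The thread is about to await a signal that is not true. -/
def Thread.Blocked (E : Env) : Thread → Prop
  | .await (.sig s) => E s ≠ some true
  | .seq T _ => T.Blocked E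
  | .watch (.sig _) T => T.Blocked E
  | _ => False

theorem Thread.Blocked.suspended {T : Thread} (h : T.Blocked E) : T.Suspended D E := by
  intro P T' E' hs
  induction hs with
  | await s E hs => exact h hs
  | seqCtx _ _ _ _ _ _ _ ih => exact ih h
  | watchCtx _ _ _ _ _ _ _ ih => exact ih h
  | _ => exact h.elim

end Suspended

theorem Name.finite_sigs : ∀ x : Name, x.sigs.Finite
  | .sig s => Set.finite_singleton s
  | .var _ => Set.finite_empty

theorem Thread.finite_sigs (T : Thread) : T.sigs.Finite := by
  induction T with
  | nil => exact Set.finite_empty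
  | seq T T' h h' => exact h.union h'
  | emit x => exact x.finite_sigs
  | nu _ h => exact h
  | thread _ h => exact h
  | await x => exact x.finite_sigs
  | watch x T h => exact x.finite_sigs.union h
  | call A xs =>
    refine (xs.finite_toSet.biUnion fun x _ => x.finite_sigs).subset ?_
    rintro s ⟨x, hx, hs⟩
    exact Set.mem_biUnion hx hs

theorem finite_progSigs (P : Multiset Thread) : (progSigs P).Finite := by
  classical
  refine (P.toFinset.finite_toSet.biUnion fun T _ => T.finite_sigs).subset ?_
  rintro s ⟨T, hT, hs⟩
  exact Set.mem_biUnion (by simpa using hT) hs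

section StartEnv

variable {J : Interface} {I : Set ℕ} {P : Multiset Thread} {s : ℕ}

theorem infinite_startEnv_eq_none (hI : I ⊆ J.input) (P : Multiset Thread) :
    {s | startEnv J I P s = none}.Infinite := by
  refine (J.infinite_compl.sdiff (finite_progSigs P)).mono ?_
  rintro s ⟨hJ, hP⟩
  have hsI : s ∉ I := fun h => hJ (.inl (hI h))
  have hs : s ∉ J.input ∪ J.output ∪ progSigs P := not_or.2 ⟨hJ, hP⟩
  rw [Set.mem_ofPred_eq, startEnv, if_neg hsI, if_neg hs]

theorem startEnv_ne_none (h : s ∈ J.input ∪ J.output ∪ progSigs P) :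
    startEnv J I P s ≠ none := by
  unfold startEnv
  split_ifs <;> simp

theorem startEnv_eq_false (hI : I ⊆ J.input) (h : s ∈ J.input ∪ J.output ∪ progSigs P)
    (hs : s ∉ J.input) : startEnv J I P s = some false := by
  rw [startEnv, if_neg fun h => hs (hI h), if_pos h]

theorem startEnv_ne_true (hI : I ⊆ J.input) (hs : s ∉ J.input) :
    startEnv J I P s ≠ some true := by
  rw [startEnv, if_neg fun h => hs (hI h)]
  split_ifs <;> simp

end StartEnv

/-- Whatever the input, `P` can perform an instant, and every instant it can perform yields
outputs and a program satisfying `K`. -/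
def EveryInstant (J : Interface) (D : List Equation) (P : Multiset Thread)
    (K : Set ℕ → Multiset Thread → Prop) : Prop :=
  ∀ I ⊆ J.input, (∃ O P', Instant J D P I O P') ∧ ∀ O P', Instant J D P I O P' → K O P'

theorem EveryInstant.of_settles {J : Interface} {D : List Equation} {P : Multiset Thread}
    {K : Set ℕ → Multiset Thread → Prop}
    (h : ∀ I ⊆ J.input, Settles D
      (fun Q E => K {s | s ∈ J.output ∧ E s = some true} (Q.map (Thread.floor E))) P
      (startEnv J I P)) :
    EveryInstant J D P K := by
  intro I hI
  constructor
  · obtain ⟨⟨Q, E⟩, hd, hF⟩ := (h I hI).1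
    exact ⟨_, _, hI, Q, E, hd, hF, rfl, rfl⟩
  · rintro O P' ⟨-, Q, E, hd, hF, rfl, rfl⟩
    exact (h I hI).2 (Q, E) hd hF

section Runs

variable {J : Interface} {D : List Equation}

theorem exists_run_mem {Q : ℕ → Multiset Thread} {I O : ℕ → Set ℕ}
    (h : ∀ n, Instant J D (Q n) (I n) (O n) (Q (n + 1))) (n : ℕ) :
    ∃ w, Run J D (Q 0) w (Q (n + 1)) ∧ (I n, O n) ∈ w := by
  induction n generalizing Q I O with
  | zero => exact ⟨[(I 0, O 0)], .cons _ _ _ _ _ _ (h 0) (.nil _), List.mem_singleton_self _⟩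
  | succ n ih =>
    obtain ⟨w, hw, hmem⟩ := ih (Q := fun n => Q (n + 1)) (I := fun n => I (n + 1))
      (O := fun n => O (n + 1)) fun n => h (n + 1)
    exact ⟨_, .cons _ _ _ _ _ _ (h 0) hw, List.mem_cons_of_mem _ hmem⟩

theorem Reactive.exists_infinite_run {P : Multiset Thread} (hP : Reactive J D P) :
    ∃ (Q : ℕ → Multiset Thread) (O : ℕ → Set ℕ),
      Q 0 = P ∧ ∀ n, Instant J D (Q n) ∅ (O n) (Q (n + 1)) := by
  obtain ⟨R, hPR, hR⟩ := hP
  choose O Q hQ hQR using fun P : R => hR P.1 P.2 ∅ (Set.empty_subset _)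
  let f : R → R := fun P => ⟨Q P, hQR P⟩
  refine ⟨fun n => (f^[n] ⟨P, hPR⟩).1, fun n => O (f^[n] ⟨P, hPR⟩), rfl, fun n => ?_⟩
  simpa only [Function.iterate_succ_apply'] using hQ (f^[n] ⟨P, hPR⟩)

theorem MustEmit.mayEmit {P : Multiset Thread} {s : ℕ} (h : MustEmit J D P s)
    (hP : Reactive J D P) : MayEmit J D P s := by
  obtain ⟨Q, O, rfl, hQ⟩ := hP.exists_infinite_run
  obtain ⟨n, hn⟩ := h.1 Q (fun _ => ∅) O rfl hQ
  obtain ⟨w, hw, hmem⟩ := exists_run_mem hQ n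
  exact ⟨w, _, hw, _, hmem, hn⟩

end Runs

/-- Each instant of a program representing a configuration `k` of the transition system `next`
performs one transition and emits `s` exactly if there is none; `rep none` describes the programs
that remain after a halting configuration. -/
structure Simulation {σ : Type*} (J : Interface) (D : List Equation) (next : σ → Option σ)
    (s : ℕ) (rep : Option σ → Multiset Thread → Prop) : Prop where
  active {k : σ} {P : Multiset Thread} : rep (some k) P →
    EveryInstant J D P fun O P' => (s ∈ O ↔ next k = none) ∧ rep (next k) P'
  halted {P : Multiset Thread} : rep none P → EveryInstant J D P fun _ P' => rep none P'

namespace Simulation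

variable {σ : Type*} {J : Interface} {D : List Equation} {next : σ → Option σ} {s : ℕ}
  {rep : Option σ → Multiset Thread → Prop} {k : σ} {P : Multiset Thread}

theorem everyInstant (h : Simulation J D next s rep) {x : Option σ} (hP : rep x P) :
    EveryInstant J D P fun _ P' => ∃ y, rep y P' := by
  intro I hI
  cases x with
  | none => exact (h.halted hP I hI).imp_right fun h' O P' hi => ⟨_, h' O P' hi⟩
  | some k => exact (h.active hP I hI).imp_right fun h' O P' hi => ⟨_, (h' O P' hi).2⟩

theorem reactive (h : Simulation J D next s rep) {x : Option σ} (hP : rep x P) :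
    Reactive J D P := by
  refine ⟨{P | ∃ x, rep x P}, ⟨x, hP⟩, ?_⟩
  rintro Q ⟨y, hQ⟩ I hI
  obtain ⟨⟨O, Q', hi⟩, hall⟩ := h.everyInstant hQ I hI
  exact ⟨O, Q', hi, hall O Q' hi⟩

theorem exists_rep_of_run (h : Simulation J D next s rep) {P' : Multiset Thread}
    {w : List (Set ℕ × Set ℕ)} (hr : Run J D P w P') {x : Option σ} (hP : rep x P) :
    ∃ y, rep y P' := by
  induction hr generalizing x with
  | nil P => exact ⟨x, hP⟩
  | cons P P' _ I O _ hi _ ih =>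
    obtain ⟨y, hy⟩ := (h.everyInstant hP I hi.1).2 O P' hi
    exact ih hy

theorem eval_dom_of_mayEmit (h : Simulation J D next s rep) (hP : rep (some k) P)
    (hs : MayEmit J D P s) : (StateTransition.eval next k).Dom := by
  obtain ⟨_, P', hr, hw⟩ := hs
  induction hr generalizing k with
  | nil P => simp at hw
  | cons P P' _ I O _ hi _ ih =>
    obtain ⟨hO, hP'⟩ := (h.active hP I hi.1).2 O P' hi
    cases hk : next k with
    | none => exact Part.dom_iff_mem.2 ⟨k, StateTransition.mem_eval.2 ⟨.refl, hk⟩⟩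
    | some k' =>
      rw [hk] at hO hP'
      rw [StateTransition.reaches_eval (.single hk)]
      exact ih hP' (by simpa [hO] using hw)

theorem exists_mem_of_reaches (h : Simulation J D next s rep) {l : σ}
    (hkl : StateTransition.Reaches next k l) (hl : next l = none) {Q : ℕ → Multiset Thread}
    {I O : ℕ → Set ℕ} (hQ : rep (some k) (Q 0))
    (hi : ∀ n, Instant J D (Q n) (I n) (O n) (Q (n + 1))) : ∃ n, s ∈ O n := by
  induction hkl using Relation.ReflTransGen.head_induction_on generalizing Q I O with
  | refl => exact ⟨0, ((h.active hQ _ (hi 0).1).2 _ _ (hi 0)).1.2 hl⟩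
  | @head k k' hkk' _ ih =>
    have hQ' := ((h.active hQ _ (hi 0).1).2 _ _ (hi 0)).2
    rw [show next k = some k' from hkk'] at hQ'
    obtain ⟨n, hn⟩ := ih (Q := fun n => Q (n + 1)) hQ' fun n => hi (n + 1)
    exact ⟨n + 1, hn⟩

theorem mustEmit_of_eval_dom (h : Simulation J D next s rep) (hP : rep (some k) P)
    (hk : (StateTransition.eval next k).Dom) : MustEmit J D P s := by
  obtain ⟨l, hl⟩ := Part.dom_iff_mem.1 hk
  obtain ⟨hkl, hl⟩ := StateTransition.mem_eval.1 hl
  refine ⟨fun Q I O hQ hi => h.exists_mem_of_reaches hkl hl (hQ ▸ hP) hi, fun _ P' hr hmax => ?_⟩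
  obtain ⟨y, hy⟩ := h.exists_rep_of_run hr hP
  obtain ⟨⟨O, P'', hi⟩, -⟩ := h.everyInstant hy ∅ (Set.empty_subset _)
  exact absurd hi (hmax _ _ _)

theorem mustEmit_iff (h : Simulation J D next s rep) (hP : rep (some k) P) :
    MustEmit J D P s ↔ (StateTransition.eval next k).Dom :=
  ⟨fun hs => h.eval_dom_of_mayEmit hP (hs.mayEmit (h.reactive hP)), h.mustEmit_of_eval_dom hP⟩

theorem mayEmit_iff (h : Simulation J D next s rep) (hP : rep (some k) P) :
    MayEmit J D P s ↔ (StateTransition.eval next k).Dom :=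
  ⟨h.eval_dom_of_mayEmit hP,
    fun hk => (h.mustEmit_of_eval_dom hP hk).mayEmit (h.reactive hP)⟩

end Simulation

/-! ### Counters and control -/

/-- The operations that a counter performs on command. -/
inductive Op where
  | inc
  | dec
  | keep

/-- The effect of an operation on the contents of a counter; on zero `dec` is never commanded. -/
def Op.apply : Op → ℕ → ℕ
  | .inc, n => n + 1
  | .dec, n => n - 1
  | .keep, n => n

/-- The global signals: the clock is emitted in every instant and `never` in none, the control
thread sends `command c o` to the counter `c`, and the counter `c` announces `status c b` in every
instant, `b` telling whether it is zero. -/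
inductive Port where
  | clock
  | never
  | output
  | command (c : Fin 2) (o : Op)
  | status (c : Fin 2) (b : Bool)

open Op Port

/-- All ports, in the order in which they are passed as arguments. -/
def ports : List Port :=
  [clock, never, output, command 0 inc, command 1 inc, command 0 dec, command 1 dec,
    command 0 keep, command 1 keep, status 0 true, status 1 true, status 0 false, status 1 false]

/-- The position of a port in `ports`. -/
def Port.index : Port → ℕ
  | clock => 0
  | never => 1
  | output => 2
  | command c inc => 3 + c
  | command c dec => 5 + c
  | command c keep => 7 + c
  | status c true => 9 + c
  | status c false => 11 + c

theorem Port.getElem?_index (p : Port) : ports[p.index]? = some p := by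
  rcases p with _ | _ | _ | ⟨c, _ | _ | _⟩ | ⟨c, _ | _⟩ <;> try fin_cases c
  all_goals rfl

theorem Port.mem_ports (p : Port) : p ∈ ports :=
  List.mem_of_getElem? p.getElem?_index

theorem Port.index_injective : Function.Injective Port.index := fun p q h =>
  Option.some_injective _ (by rw [← p.getElem?_index, h, q.getElem?_index])

/-- The name seen from below one more binder. -/
def Name.lift : Name → Name
  | .sig s => .sig s
  | .var i => .var (i + 1)

theorem Name.inst_lift (σ : List ℕ) (x : Name) : x.lift.inst 1 σ = (x.inst 0 σ).lift := by
  cases x with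
  | sig s => rfl
  | var i =>
    have hi : ¬ i + 1 < 1 := by omega
    simp only [Name.lift, Name.inst, hi, Nat.not_lt_zero, if_false, Nat.add_sub_cancel,
      Nat.sub_zero]
    cases h : σ[i]? with
    | some s => rfl
    | none =>
      have := List.getElem?_eq_none_iff.1 h
      exact congrArg Name.var (by omega)

section Templates

variable (nm : Port → Name)

/-- Wait until the end of the instant. -/
def pause : Thread := .watch (nm clock) (.await (nm never))

/-- On `p` run `T`, in the present instant only. -/
def branch (p : Port) (T : Thread) : Thread := .watch (nm clock) (.seq (.await (nm p)) T)

/-- A counter is a stack of frames, each waiting for a private signal. The thread at the top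
announces its status on `st` and wakes the topmost frame by emitting `x`. -/
def counterCall (c : Fin 2) (st x : Name) : Thread := .call c (ports.map nm ++ [st, x])

/-- The thread at the top of a counter puts itself to sleep in a frame waiting for `y`, and a new
thread takes its place. -/
def push (c : Fin 2) (st x y : Name) : Thread :=
  .seq (.thread (.seq (.await y) (.seq (pause nm) (counterCall nm c st x))))
    (.seq (pause nm) (counterCall nm c (nm (status c false)) y))

/-- The reaction of the thread at the top of a counter to a command. -/
def obey (c : Fin 2) (st x : Name) : Op → Thread
  | inc => .thread (.nu (push (fun p => (nm p).lift) c st.lift x.lift (.var 0)))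
  | dec => .emit x
  | keep => .thread (.seq (pause nm) (counterCall nm c st x))

/-- The thread at the top of a counter announces its status and obeys one command. -/
def counterBody (c : Fin 2) (st x : Name) : Thread :=
  .seq (.emit st) <|
  .seq (.thread (branch nm (command c inc) (obey nm c st x inc))) <|
  .seq (.thread (branch nm (command c dec) (obey nm c st x dec))) <|
  branch nm (command c keep) (obey nm c st x keep)

/-- The control thread continues with the identifier `i`. -/
def controlCall (i : ℕ) : Thread := .call i (ports.map nm)

/-- The commands for operating on the counter `c` only. -/
def commands (c : Fin 2) (o : Op) : Fin 2 → Op := Function.update (fun _ => keep) c o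

/-- The control thread reacts to the status of the counter `c`: it has the operation `o` performed
and continues with the identifier `i`, or it halts. -/
def reply (c : Fin 2) : Option (Op × ℕ) → Thread
  | none => .emit (nm output)
  | some (o, i) =>
    .seq (.emit (nm (command 0 (commands c o 0)))) <|
    .seq (.emit (nm (command 1 (commands c o 1)))) <|
    .seq (pause nm) (controlCall nm i)

/-- The control thread in a state concerning the counter `c`, where `a b` is the reaction to the
status `b` of the counter. -/
def controlBody (c : Fin 2) (a : Bool → Option (Op × ℕ)) : Thread :=
  .seq (.emit (nm clock)) <|
  .seq (.thread (branch nm (status c true) (.thread (reply nm c (a true))))) <|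
  branch nm (status c false) (.thread (reply nm c (a false)))

variable {nm} {k : ℕ} {σ : List ℕ} {c : Fin 2} {st x y : Name}

theorem inst_counterCall : (counterCall nm c st x).inst k σ =
    counterCall (fun p => (nm p).inst k σ) c (st.inst k σ) (x.inst k σ) := by
  simp [counterCall, Thread.inst]

theorem inst_push : (push nm c st x y).inst k σ =
    push (fun p => (nm p).inst k σ) c (st.inst k σ) (x.inst k σ) (y.inst k σ) := by
  simp [push, pause, Thread.inst, inst_counterCall]

theorem inst_counterBody : (counterBody nm c st x).inst 0 σ =
    counterBody (fun p => (nm p).inst 0 σ) c (st.inst 0 σ) (x.inst 0 σ) := by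
  have h : Name.inst 1 σ (.var 0) = .var 0 := rfl
  simp [counterBody, obey, branch, pause, Thread.inst, inst_counterCall, inst_push, Name.inst_lift,
    h]

theorem inst_reply (a : Option (Op × ℕ)) : (reply nm c a).inst k σ =
    reply (fun p => (nm p).inst k σ) c a := by
  rcases a with _ | ⟨o, i⟩ <;> simp [reply, pause, controlCall, Thread.inst]

theorem inst_controlBody (a : Bool → Option (Op × ℕ)) : (controlBody nm c a).inst k σ =
    controlBody (fun p => (nm p).inst k σ) c a := by
  simp [controlBody, branch, Thread.inst, inst_reply]

end Templates

/-- The parameters of the identifiers: the ports come first. -/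
def portVar (p : Port) : Name := .var p.index

/-- The equation of the counter `c`; the last two parameters are its status port and the signal that
wakes the topmost frame. -/
def counterEq (c : Fin 2) : Equation :=
  ⟨ports.length + 2,
    counterBody portVar c (.var ports.length) (.var (ports.length + 1))⟩

/-- The equation of a control state; its parameters are the ports. -/
def controlEq (c : Fin 2) (a : Bool → Option (Op × ℕ)) : Equation :=
  ⟨ports.length, controlBody portVar c a⟩

theorem Port.index_lt (p : Port) : p.index < ports.length :=
  (List.getElem?_eq_some_iff.1 p.getElem?_index).1

section Stacks

variable (g : Port → ℕ)

/-- The port `p` once the global signals are known. -/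
def portSig (p : Port) : Name := .sig (g p)

/-- The call of the thread at the top of a stack of frames waiting for `xs`. An empty stack has no
topmost frame; the clock is passed in its place. -/
def stackCall (c : Fin 2) (xs : List ℕ) : Thread :=
  counterCall (portSig g) c (portSig g (status c xs.isEmpty)) (.sig (xs.headD (g clock)))

/-- The frame waiting for `x` on top of the frames waiting for `xs`. -/
def frame (c : Fin 2) (x : ℕ) (xs : List ℕ) : Thread :=
  .seq (.await (.sig x)) (.seq (pause (portSig g)) (stackCall g c xs))

/-- The stack of frames waiting for `xs`, the head of the list being the topmost frame. -/
def frames (c : Fin 2) : List ℕ → Multiset Thread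
  | [] => 0
  | x :: xs => {frame g c x xs} + frames c xs

/-- The reaction to a command of the thread at the top of the stack `xs`. -/
def stackBranch (c : Fin 2) (xs : List ℕ) (o : Op) : Thread :=
  branch (portSig g) (command c o)
    (obey (portSig g) c (portSig g (status c xs.isEmpty)) (.sig (xs.headD (g clock))) o)

/-- A counter at the beginning of an instant. -/
def counterReady (c : Fin 2) (xs : List ℕ) : Multiset Thread :=
  {.seq .nil (stackCall g c xs)} + frames g c xs

/-- A counter that has announced its status. -/
def counterListening (c : Fin 2) (xs : List ℕ) : Multiset Thread :=
  {stackBranch g c xs inc} + ({stackBranch g c xs dec} +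
    ({stackBranch g c xs keep} + frames g c xs))

/-- A counter that has obeyed. -/
def counterPausing (c : Fin 2) (xs : List ℕ) : Multiset Thread :=
  {.seq (pause (portSig g)) (stackCall g c xs)} + frames g c xs

variable {g}

theorem inst_portVar (p : Port) (l : List ℕ) :
    (portVar p).inst 0 (ports.map g ++ l) = portSig g p := by
  have h : (ports.map g ++ l)[p.index]? = some (g p) := by
    rw [List.getElem?_append_left (by simpa using p.index_lt), List.getElem?_map,
      p.getElem?_index, Option.map_some]
  simp [portVar, Name.inst, portSig, h]

theorem inst_counterEq_body (c : Fin 2) (s t : ℕ) :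
    (counterEq c).body.inst 0 (ports.map g ++ [s, t]) =
      counterBody (portSig g) c (.sig s) (.sig t) := by
  have hs : Name.inst 0 (ports.map g ++ [s, t]) (.var ports.length) = .sig s := by
    simp [Name.inst]
  have ht : Name.inst 0 (ports.map g ++ [s, t]) (.var (ports.length + 1)) = .sig t := by
    simp [Name.inst]
  rw [counterEq, inst_counterBody, hs, ht]
  simp only [inst_portVar]

theorem inst_controlEq_body (c : Fin 2) (a : Bool → Option (Op × ℕ)) :
    (controlEq c a).body.inst 0 (ports.map g) = controlBody (portSig g) c a := by
  have h := inst_portVar (g := g) (l := [])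
  simp only [List.append_nil] at h
  simp only [controlEq, inst_controlBody, h]

theorem mem_frames {c : Fin 2} {xs : List ℕ} {T : Thread} (h : T ∈ frames g c xs) :
    ∃ x ∈ xs, ∃ U, T = .seq (.await (.sig x)) U := by
  induction xs with
  | nil => simp [frames] at h
  | cons x xs ih =>
    rw [frames, Multiset.singleton_add, Multiset.mem_cons] at h
    obtain rfl | h := h
    · exact ⟨x, by simp, _, rfl⟩
    · obtain ⟨y, hy, h⟩ := ih h
      exact ⟨y, by simp [hy], h⟩

theorem mem_progSigs_frames {c : Fin 2} {xs : List ℕ} {x : ℕ} (h : x ∈ xs) :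
    x ∈ progSigs (frames g c xs) := by
  induction xs with
  | nil => simp at h
  | cons y xs ih =>
    obtain rfl | h := List.mem_cons.1 h
    · exact ⟨frame g c x xs, by simp [frames], by simp [frame, Thread.sigs, Name.sigs]⟩
    · obtain ⟨T, hT, hs⟩ := ih h
      exact ⟨T, by simp [frames, hT], hs⟩

theorem map_floor_frames (E : Env) (c : Fin 2) (xs : List ℕ) :
    (frames g c xs).map (Thread.floor E) = frames g c xs := by
  refine (Multiset.map_congr rfl fun T hT => ?_).trans (Multiset.map_id _)
  obtain ⟨x, -, U, rfl⟩ := mem_frames hT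
  rfl

end Stacks

/-- The signals that are shared by the threads or with the environment. -/
def publicSigs (J : Interface) (g : Port → ℕ) : Set ℕ := J.input ∪ Set.range g

/-- `g` chooses the global signals, only the output being observable. -/
structure Wiring (J : Interface) (g : Port → ℕ) : Prop where
  injective : Function.Injective g
  not_input (p : Port) : g p ∉ J.input
  output_mem : g output ∈ J.output

/-- The environment during an instant in which the global signals in `S` have been emitted so far
and the frames wait for the signals in `l`. -/
structure Inv (J : Interface) (g : Port → ℕ) (S : Set Port) (E : Env) (l : List ℕ) : Prop where
  infinite : {s | E s = none}.Infinite
  ne_none {s : ℕ} : s ∈ publicSigs J g → E s ≠ none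
  eq_true (p : Port) : E (g p) = some true ↔ p ∈ S
  nodup : l.Nodup
  eq_false {x : ℕ} : x ∈ l → E x = some false
  notMem {x : ℕ} : x ∈ l → x ∉ publicSigs J g

section Instants

variable {J : Interface} {g : Port → ℕ} {D : List Equation} {S : Set Port} {E : Env}
  {l : List ℕ}

theorem mem_publicSigs (p : Port) : g p ∈ publicSigs J g := .inr ⟨p, rfl⟩

namespace Inv

theorem perm {l' : List ℕ} (h : Inv J g S E l) (hl : l.Perm l') : Inv J g S E l' :=
  { h with
    nodup := hl.nodup_iff.1 h.nodup
    eq_false := fun hx => h.eq_false (hl.mem_iff.2 hx)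
    notMem := fun hx => h.notMem (hl.mem_iff.2 hx) }

theorem emit (h : Inv J g S E l) (hg : Function.Injective g) (p : Port) :
    Inv J g (insert p S) (Function.update E (g p) (some true)) l where
  infinite := Label.infinite_effect_eq_none (a := .emit (g p)) h.infinite
  ne_none hs := Label.effect_ne_none (a := .emit (g p)) (h.ne_none hs)
  eq_true q := by
    obtain rfl | hq := eq_or_ne q p
    · simp
    · rw [Function.update_of_ne (hg.ne hq), h.eq_true, Set.mem_insert_iff, or_iff_right hq]
  nodup := h.nodup
  eq_false {x} hx := by
    have : x ≠ g p := fun hxp => h.notMem hx (hxp ▸ mem_publicSigs p)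
    rw [Function.update_of_ne this, h.eq_false hx]
  notMem := h.notMem

theorem push (h : Inv J g S E l) {y : ℕ} (hy : E y = none) :
    Inv J g S (Function.update E y (some false)) (y :: l) where
  infinite := Label.infinite_effect_eq_none (a := .nu y) h.infinite
  ne_none hs := Label.effect_ne_none (a := .nu y) (h.ne_none hs)
  eq_true p := by
    have : g p ≠ y := fun hp => h.ne_none (mem_publicSigs p) (hp ▸ hy)
    rw [Function.update_of_ne this, h.eq_true]
  nodup := List.nodup_cons.2 ⟨fun hl => by simp [h.eq_false hl] at hy, h.nodup⟩
  eq_false {x} hx := by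
    rw [Function.update_apply]
    split_ifs with hxy
    · rfl
    · exact h.eq_false ((List.mem_cons.1 hx).resolve_left hxy)
  notMem hx := by
    obtain rfl | hx := List.mem_cons.1 hx
    · exact fun hs => h.ne_none hs hy
    · exact h.notMem hx

theorem pop {x : ℕ} (h : Inv J g S E (x :: l)) :
    Inv J g S (Function.update E x (some true)) l where
  infinite := Label.infinite_effect_eq_none (a := .emit x) h.infinite
  ne_none hs := Label.effect_ne_none (a := .emit x) (h.ne_none hs)
  eq_true p := by
    have : g p ≠ x := fun hp => h.notMem List.mem_cons_self (hp ▸ mem_publicSigs p)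
    rw [Function.update_of_ne this, h.eq_true]
  nodup := (List.nodup_cons.1 h.nodup).2
  eq_false {y} hy := by
    have : y ≠ x := fun hyx => (List.nodup_cons.1 h.nodup).1 (hyx ▸ hy)
    rw [Function.update_of_ne this, h.eq_false (List.mem_cons_of_mem _ hy)]
  notMem hx := h.notMem (List.mem_cons_of_mem _ hx)

end Inv

/-- Threads that do nothing in an instant in which the global signals in `S` are emitted. -/
def Inert (g : Port → ℕ) (S : Set Port) (T : Thread) : Prop :=
  T = .nil ∨ ∃ p ∉ S, ∃ U, T = branch (portSig g) p U

theorem inert_branch {p : Port} (hp : p ∉ S) (U : Thread) :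
    Inert g S (branch (portSig g) p U) :=
  .inr ⟨p, hp, U, rfl⟩

theorem Inert.suspended {T : Thread} (h : Inert g S T) (hI : Inv J g S E l) :
    T.Suspended D E := by
  obtain rfl | ⟨p, hp, U, rfl⟩ := h
  · exact suspended_nil
  · exact Thread.Blocked.suspended (mt (hI.eq_true p).1 hp)

theorem Inert.floor_eq_nil {T : Thread} (h : Inert g S T) (hc : E (g clock) = some true) :
    T.floor E = .nil := by
  obtain rfl | ⟨p, -, U, rfl⟩ := h
  · rfl
  · exact if_pos hc

theorem floor_seq_pause {U : Thread} (hc : E (g clock) = some true) :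
    (Thread.seq (pause (portSig g)) U).floor E = .seq .nil U :=
  congrArg (Thread.seq · U) (if_pos hc)

theorem suspended_seq_pause {U : Thread} (h : E (g never) ≠ some true) :
    Thread.Suspended D (.seq (pause (portSig g)) U) E :=
  Thread.Blocked.suspended h

theorem suspended_of_mem_frames {c : Fin 2} {xs : List ℕ} {T : Thread} (hT : T ∈ frames g c xs)
    (hI : Inv J g S E l) (hxs : xs ⊆ l) : T.Suspended D E := by
  obtain ⟨x, hx, U, rfl⟩ := mem_frames hT
  refine Thread.Blocked.suspended (T := .seq (.await (.sig x)) U) ?_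
  simp [Thread.Blocked, hI.eq_false (hxs hx)]

section Counters

variable {K : Multiset Thread → Env → Prop} {R : Multiset Thread} {c : Fin 2} {xs ys : List ℕ}

theorem lstep_stackCall (hD : D[(c : ℕ)]? = some (counterEq c)) (xs : List ℕ) :
    LStep D (stackCall g c xs) .tau 0
      (counterBody (portSig g) c (portSig g (status c xs.isEmpty))
        (.sig (xs.headD (g clock)))) := by
  have h := LStep.call (D := D) c (ports.map g ++ [g (status c xs.isEmpty), xs.headD (g clock)])
    (counterEq c) hD (by simp [counterEq])
  rw [inst_counterEq_body] at h
  rwa [List.map_append, List.map_map] at h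

theorem settles_counterReady (hg : Function.Injective g) (hD : D[(c : ℕ)]? = some (counterEq c))
    (hI : Inv J g S E l)
    (hK : ∀ E', Inv J g (insert (status c xs.isEmpty) S) E' l →
      Settles D K (counterListening g c xs + R) E') :
    Settles D K (counterReady g c xs + R) E := by
  rw [counterReady, add_assoc]
  refine .tau (.seqNil _) <| .tau (lstep_stackCall hD xs) <|
    .seq_emit (hI.ne_none (mem_publicSigs _)) <| .seq_thread <| .seq_thread ?_
  convert hK _ (hI.emit hg _) using 1
  simp only [counterListening, stackBranch]
  abel

theorem inst_push_lift (c : Fin 2) (xs : List ℕ) (y : ℕ) :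
    (push (fun p => (portSig g p).lift) c (portSig g (status c xs.isEmpty)).lift
      (Name.sig (xs.headD (g clock))).lift (.var 0)).inst 0 [y] =
      .seq (.thread (frame g c y xs)) (.seq (pause (portSig g)) (stackCall g c (y :: xs))) :=
  inst_push

theorem settles_counterListening_inc (hI : Inv J g S E (xs ++ ys)) (hS : command c inc ∈ S)
    (hK : ∀ y E', Inv J g S E' (y :: xs ++ ys) → Settles D K (counterPausing g c (y :: xs) +
      ({.nil} + ({stackBranch g c xs dec} + {stackBranch g c xs keep}) + R)) E') :
    Settles D K (counterListening g c xs + R) E := by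
  rw [counterListening, add_assoc]
  refine .watch_await_thread ((hI.eq_true _).2 hS) <| .nu hI.infinite fun y hy => ?_
  rw [inst_push_lift]
  refine .seq_thread ?_
  convert hK y _ (hI.push hy) using 1
  rw [counterPausing, frames]
  abel

theorem settles_counterListening_dec {x : ℕ} (hI : Inv J g S E (x :: xs ++ ys))
    (hS : command c dec ∈ S)
    (hK : ∀ E', Inv J g S E' (xs ++ ys) → Settles D K (counterPausing g c xs +
      ({.nil} + ({stackBranch g c (x :: xs) inc} + {stackBranch g c (x :: xs) keep}) + R)) E') :
    Settles D K (counterListening g c (x :: xs) + R) E := by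
  rw [counterListening, add_assoc, add_left_comm, add_assoc]
  have hx : E x ≠ none := by simp [hI.eq_false (x := x) (by simp)]
  refine .watch_await_emit (t := x) ((hI.eq_true _).2 hS) hx ?_
  suffices h : Settles D K ({frame g c x xs} + (frames g c xs +
      ({.nil} + ({stackBranch g c (x :: xs) inc} + {stackBranch g c (x :: xs) keep}) + R)))
      (Function.update E x (some true)) by
    convert h using 1
    rw [frames]
    abel
  refine .seq_await (Function.update_self ..) ?_
  rw [← add_assoc]
  exact hK _ hI.pop

theorem settles_counterListening_keep (hI : Inv J g S E l) (hS : command c keep ∈ S)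
    (hK : Settles D K (counterPausing g c xs +
      ({.nil} + ({stackBranch g c xs inc} + {stackBranch g c xs dec}) + R)) E) :
    Settles D K (counterListening g c xs + R) E := by
  have h : counterListening g c xs + R = {stackBranch g c xs keep} + ({stackBranch g c xs inc} +
      ({stackBranch g c xs dec} + (frames g c xs + R))) := by
    rw [counterListening]
    abel
  rw [h]
  refine .watch_await_thread ((hI.eq_true _).2 hS) ?_
  convert hK using 1
  rw [counterPausing, stackCall]
  abel

/-- Exactly one command being given, the branches for the other ones remain inert. -/
theorem settles_counterListening {o : Op} (hI : Inv J g S E (xs ++ ys))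
    (hS : ∀ o', command c o' ∈ S ↔ o' = o) (ho : o = dec → xs ≠ [])
    (hK : ∀ xs' E' N, xs'.length = o.apply xs.length → Inv J g S E' (xs' ++ ys) →
      (∀ T ∈ N, Inert g S T) → Settles D K (counterPausing g c xs' + (N + R)) E') :
    Settles D K (counterListening g c xs + R) E := by
  have hinert {o₁ o₂ : Op} {l : List ℕ} (h₁ : o₁ ≠ o) (h₂ : o₂ ≠ o) : ∀ T ∈ {Thread.nil} +
      ({stackBranch g c l o₁} + {stackBranch g c l o₂} : Multiset Thread), Inert g S T := by
    simp only [Multiset.mem_add, Multiset.mem_singleton]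
    rintro T (rfl | rfl | rfl)
    · exact .inl rfl
    · exact inert_branch (mt (hS _).1 h₁) _
    · exact inert_branch (mt (hS _).1 h₂) _
  cases o with
  | inc =>
    exact settles_counterListening_inc hI ((hS _).2 rfl) fun y E' hI' =>
      hK _ _ _ rfl hI' (hinert (by simp) (by simp))
  | dec =>
    obtain ⟨x, xs, rfl⟩ := List.exists_cons_of_ne_nil (ho rfl)
    exact settles_counterListening_dec hI ((hS _).2 rfl) fun E' hI' =>
      hK _ _ _ rfl hI' (hinert (by simp) (by simp))
  | keep =>
    exact settles_counterListening_keep hI ((hS _).2 rfl) <|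
      hK _ _ _ rfl hI (hinert (by simp) (by simp))

end Counters

section Control

variable {K : Multiset Thread → Env → Prop} {R : Multiset Thread} {c : Fin 2} {i : ℕ}
  {a : Bool → Option (Op × ℕ)}

theorem lstep_controlCall (hD : D[i]? = some (controlEq c a)) :
    LStep D (controlCall (portSig g) i) .tau 0 (controlBody (portSig g) c a) := by
  have h := LStep.call (D := D) i (ports.map g) _ hD (by simp [controlEq])
  rw [inst_controlEq_body] at h
  rwa [List.map_map] at h

theorem settles_control (hg : Function.Injective g) (hD : D[i]? = some (controlEq c a))
    (hI : Inv J g S E l) {b : Bool} (hb : status c b ∈ S)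
    (hK : ∀ E', Inv J g (insert clock S) E' l →
      Settles D K ({reply (portSig g) c (a b)} + ({.nil} +
        ({branch (portSig g) (status c !b) (.thread (reply (portSig g) c (a !b)))} + R))) E') :
    Settles D K ({.seq .nil (controlCall (portSig g) i)} + R) E := by
  refine .tau (.seqNil _) <| .tau (lstep_controlCall hD) <|
    .seq_emit (hI.ne_none (mem_publicSigs _)) <| .seq_thread ?_
  have hI' := hI.emit hg clock
  have hb' := (hI'.eq_true (status c b)).2 (.inr hb)
  cases b with
  | false => exact .watch_await_thread hb' (hK _ hI')
  | true =>
    rw [add_left_comm]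
    exact .watch_await_thread hb' (hK _ hI')

theorem settles_reply_some {o : Op} (hg : Function.Injective g) (hI : Inv J g S E l)
    (hK : ∀ E', Inv J g (insert (command 1 (commands c o 1))
        (insert (command 0 (commands c o 0)) S)) E' l →
      Settles D K ({.seq (pause (portSig g)) (controlCall (portSig g) i)} + R) E') :
    Settles D K ({reply (portSig g) c (some (o, i))} + R) E := by
  have hI' := hI.emit hg (command 0 (commands c o 0))
  exact .seq_emit (hI.ne_none (mem_publicSigs _)) <|
    .seq_emit (hI'.ne_none (mem_publicSigs _)) <| hK _ (hI'.emit hg _)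

end Control

end Instants

/-! ### An instant of the program -/

section Program

variable {J : Interface} {g : Port → ℕ} {D : List Equation} {S : Set Port} {E : Env}
  {I : Set ℕ} {K : Multiset Thread → Env → Prop} {P N : Multiset Thread} {xs : Fin 2 → List ℕ}
  {v : Fin 2 → ℕ} {c d : Fin 2} {i j : ℕ} {o : Op} {a : Bool → Option (Op × ℕ)}

theorem Inert.anti {S' : Set Port} {T : Thread} (h : Inert g S T) (hS : S' ⊆ S) : Inert g S' T :=
  h.imp_right fun ⟨p, hp, hT⟩ => ⟨p, fun hp' => hp (hS hp'), hT⟩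

/-- The program at the beginning of an instant. -/
def stateThreads (g : Port → ℕ) (i : ℕ) (xs : Fin 2 → List ℕ) (N : Multiset Thread) :
    Multiset Thread :=
  {.seq .nil (controlCall (portSig g) i)} +
    (counterReady g 0 (xs 0) + (counterReady g 1 (xs 1) + N))

/-- The control thread of the program is at the identifier `i`, the counters have contents `v`, and
all other threads have terminated. -/
def Represents (J : Interface) (g : Port → ℕ) (i : ℕ) (v : Fin 2 → ℕ) (P : Multiset Thread) :
    Prop :=
  ∃ xs N, P = stateThreads g i xs N ∧ (∀ c, (xs c).length = v c) ∧ (∀ T ∈ N, T = .nil) ∧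
    (xs 0 ++ xs 1).Nodup ∧ ∀ x ∈ xs 0 ++ xs 1, x ∉ publicSigs J g

/-- Each thread has terminated or awaits a signal that the environment cannot emit. -/
def Dead (J : Interface) (P : Multiset Thread) : Prop :=
  ∀ T ∈ P, T = .nil ∨ ∃ x ∉ J.input, ∃ U, T = .seq (.await (.sig x)) U

theorem inv_startEnv (hg : Wiring J g) (hI : I ⊆ J.input) (hnodup : (xs 0 ++ xs 1).Nodup)
    (hxs : ∀ x ∈ xs 0 ++ xs 1, x ∉ publicSigs J g) :
    Inv J g ∅ (startEnv J I (stateThreads g i xs N)) (xs 0 ++ xs 1) := by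
  have hport (p : Port) : g p ∈ progSigs (stateThreads g i xs N) :=
    ⟨_, Multiset.mem_add.2 (.inl (Multiset.mem_singleton_self _)),
      .inr ⟨portSig g p, List.mem_map_of_mem p.mem_ports, rfl⟩⟩
  have hframe {x : ℕ} (hx : x ∈ xs 0 ++ xs 1) : x ∈ progSigs (stateThreads g i xs N) := by
    obtain hx | hx := List.mem_append.1 hx
    · obtain ⟨T, hT, hs⟩ := mem_progSigs_frames (g := g) (c := 0) hx
      exact ⟨T, by simp [stateThreads, counterReady, hT], hs⟩
    · obtain ⟨T, hT, hs⟩ := mem_progSigs_frames (g := g) (c := 1) hx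
      exact ⟨T, by simp [stateThreads, counterReady, hT], hs⟩
  refine ⟨infinite_startEnv_eq_none hI _, ?_, fun p => ?_, hnodup, fun {x} hx => ?_, @hxs⟩
  · rintro s (hs | ⟨p, rfl⟩)
    · exact startEnv_ne_none (.inl (.inl hs))
    · exact startEnv_ne_none (.inr (hport p))
  · exact iff_of_false (startEnv_ne_true hI (hg.not_input p)) id
  · exact startEnv_eq_false hI (.inr (hframe hx)) fun h => hxs x hx (.inl h)

/-- The global signals emitted before the control thread replies. -/
def polled (xs : Fin 2 → List ℕ) : Set Port :=
  insert clock (insert (status 1 (xs 1).isEmpty) {status 0 (xs 0).isEmpty})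

theorem status_mem_polled {b : Bool} : status c b ∈ polled xs ↔ b = (xs c).isEmpty := by
  fin_cases c <;> simp [polled]

theorem settles_stateThreads (hg : Function.Injective g)
    (hD : ∀ c : Fin 2, D[(c : ℕ)]? = some (counterEq c)) (hi : D[i]? = some (controlEq c a))
    (hN : ∀ T ∈ N, T = .nil) (hI : Inv J g ∅ E (xs 0 ++ xs 1))
    (hK : ∀ E' N', Inv J g (polled xs) E' (xs 0 ++ xs 1) →
      (∀ T ∈ N', Inert g {p | p ≠ status c !(xs c).isEmpty} T) →
      Settles D K ({reply (portSig g) c (a (xs c).isEmpty)} +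
        (counterListening g 0 (xs 0) + (counterListening g 1 (xs 1) + N'))) E') :
    Settles D K (stateThreads g i xs N) E := by
  rw [stateThreads, add_left_comm]
  refine settles_counterReady hg (hD 0) hI fun E₁ hI₁ => ?_
  rw [← add_assoc, add_left_comm]
  refine settles_counterReady hg (hD 1) hI₁ fun E₂ hI₂ => ?_
  rw [insert_empty_eq] at hI₂
  suffices h : Settles D K ({.seq .nil (controlCall (portSig g) i)} +
      (counterListening g 0 (xs 0) + (counterListening g 1 (xs 1) + N))) E₂ by
    convert h using 1
    abel
  refine settles_control hg hi hI₂ (b := (xs c).isEmpty) ?_ fun E₃ hI₃ => ?_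
  · exact Set.mem_of_mem_insert_of_ne (a := clock) (status_mem_polled.2 rfl) (by simp)
  suffices h : ∀ T ∈ {Thread.nil} +
      ({branch (portSig g) (status c !(xs c).isEmpty)
        (.thread (reply (portSig g) c (a !(xs c).isEmpty)))} + N),
      Inert g {p | p ≠ status c !(xs c).isEmpty} T by
    convert hK E₃ _ hI₃ h using 1
    abel
  simp only [Multiset.mem_add, Multiset.mem_singleton]
  rintro T (rfl | rfl | hT)
  · exact .inl rfl
  · exact inert_branch (by simp) _
  · exact .inl (hN T hT)

/-- The global signals emitted in an instant in which the counters are given the commands `ops`. -/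
def commanded (xs : Fin 2 → List ℕ) (ops : Fin 2 → Op) : Set Port :=
  insert (command 1 (ops 1)) (insert (command 0 (ops 0)) (polled xs))

theorem command_mem_commanded {ops : Fin 2 → Op} :
    command c o ∈ commanded xs ops ↔ o = ops c := by
  fin_cases c <;> simp [commanded, polled]

theorem polled_subset : polled xs ⊆ {p | p ≠ status c !(xs c).isEmpty} := by
  rintro p hp rfl
  simp [status_mem_polled] at hp

theorem commanded_subset {ops : Fin 2 → Op} :
    commanded xs ops ⊆ {p | p ≠ status c !(xs c).isEmpty} :=
  Set.insert_subset (by simp) <| Set.insert_subset (by simp) polled_subset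

/-- The program at the end of an instant. -/
def pausingThreads (g : Port → ℕ) (i : ℕ) (xs : Fin 2 → List ℕ) (N : Multiset Thread) :
    Multiset Thread :=
  {.seq (pause (portSig g)) (controlCall (portSig g) i)} +
    (counterPausing g 0 (xs 0) + (counterPausing g 1 (xs 1) + N))

theorem ne_nil_of_commands_eq_dec (ho : o = dec → xs c ≠ []) (h : commands c o d = dec) :
    xs d ≠ [] := by
  obtain rfl | hd := eq_or_ne d c
  · exact ho (by rwa [commands, Function.update_self] at h)
  · simp [commands, Function.update_of_ne hd] at h

theorem final_pausingThreads (hI : Inv J g S E (xs 0 ++ xs 1)) (hnever : never ∉ S)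
    (hN : ∀ T ∈ N, Inert g S T) : Final D (pausingThreads g i xs N, E) := by
  have hE := mt (hI.eq_true never).1 hnever
  simp only [Final, pausingThreads, counterPausing, Multiset.mem_add, Multiset.mem_singleton]
  rintro T (rfl | (rfl | hT) | (rfl | hT) | hT)
  · exact suspended_seq_pause hE
  · exact suspended_seq_pause hE
  · exact suspended_of_mem_frames hT hI (List.subset_append_left _ _)
  · exact suspended_seq_pause hE
  · exact suspended_of_mem_frames hT hI (List.subset_append_right _ _)
  · exact (hN T hT).suspended hI

theorem represents_map_floor (hI : Inv J g S E (xs 0 ++ xs 1)) (hclock : clock ∈ S)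
    (hN : ∀ T ∈ N, Inert g S T) :
    Represents J g i (fun c => (xs c).length) ((pausingThreads g i xs N).map (Thread.floor E)) := by
  have hE := (hI.eq_true clock).2 hclock
  refine ⟨xs, N.map (Thread.floor E), ?_, fun _ => rfl, fun T hT => ?_, hI.nodup,
    fun _ => hI.notMem⟩
  · simp only [pausingThreads, counterPausing, stateThreads, counterReady, Multiset.map_add,
      Multiset.map_singleton, floor_seq_pause hE, map_floor_frames]
  · obtain ⟨U, hU, rfl⟩ := Multiset.mem_map.1 hT
    exact (hN U hU).floor_eq_nil hE

theorem settles_commands (hg : Function.Injective g)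
    (hI : Inv J g (polled xs) E (xs 0 ++ xs 1)) (ho : o = dec → xs c ≠ [])
    (hN : ∀ T ∈ N, Inert g {p | p ≠ status c !(xs c).isEmpty} T)
    (hK : ∀ xs' E' N', (∀ d, (xs' d).length = (commands c o d).apply (xs d).length) →
      Inv J g (commanded xs (commands c o)) E' (xs' 0 ++ xs' 1) →
      (∀ T ∈ N', Inert g (commanded xs (commands c o)) T) →
      Settles D K (pausingThreads g i xs' N') E') :
    Settles D K ({reply (portSig g) c (some (o, i))} +
      (counterListening g 0 (xs 0) + (counterListening g 1 (xs 1) + N))) E := by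
  refine settles_reply_some hg hI fun E₁ hI₁ => ?_
  change Inv J g (commanded xs (commands c o)) E₁ _ at hI₁
  rw [add_left_comm]
  refine settles_counterListening hI₁ (fun _ => command_mem_commanded)
    (ne_nil_of_commands_eq_dec ho) fun xs₀ E₂ N₀ hxs₀ hI₂ hN₀ => ?_
  suffices h : Settles D K (counterListening g 1 (xs 1) + (counterPausing g 0 xs₀ +
      ({.seq (pause (portSig g)) (controlCall (portSig g) i)} + (N₀ + N)))) E₂ by
    convert h using 1
    abel
  refine settles_counterListening (hI₂.perm List.perm_append_comm)
    (fun _ => command_mem_commanded) (ne_nil_of_commands_eq_dec ho) fun xs₁ E₃ N₁ hxs₁ hI₃ hN₁ => ?_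
  have hall : ∀ T ∈ N₁ + (N₀ + N), Inert g (commanded xs (commands c o)) T := by
    simp only [Multiset.mem_add]
    rintro T (hT | hT | hT)
    exacts [hN₁ T hT, hN₀ T hT, (hN T hT).anti commanded_subset]
  convert hK ![xs₀, xs₁] E₃ _ (Fin.forall_fin_two.2 ⟨hxs₀, hxs₁⟩)
    (hI₃.perm List.perm_append_comm) hall using 1
  simp only [pausingThreads, Matrix.cons_val_zero, Matrix.cons_val_one]
  abel

theorem Represents.everyInstant_of_eq_some (hg : Wiring J g)
    (hD : ∀ c : Fin 2, D[(c : ℕ)]? = some (counterEq c)) (hi : D[i]? = some (controlEq c a))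
    (ha : a (decide (v c = 0)) = some (o, j)) (ho : o = dec → v c ≠ 0)
    (hP : Represents J g i v P) :
    EveryInstant J D P fun O P' =>
      g output ∉ O ∧ Represents J g j (fun d => (commands c o d).apply (v d)) P' := by
  obtain ⟨xs, N, rfl, hv, hN, hnodup, hxs⟩ := hP
  have hb : (xs c).isEmpty = decide (v c = 0) := by
    rw [← hv]
    cases xs c <;> simp
  refine .of_settles fun I hI => settles_stateThreads hg.injective hD hi hN
    (inv_startEnv hg hI hnodup hxs) fun E₁ N₁ hI₁ hN₁ => ?_
  rw [hb, ha]
  have hne : o = dec → xs c ≠ [] := fun h hnil => ho h (by rw [← hv, hnil]; rfl)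
  refine settles_commands hg.injective hI₁ hne hN₁ fun xs' E₂ N₂ hxs' hI₂ hN₂ => ?_
  refine .of_final (final_pausingThreads hI₂ (by simp [commanded, polled]) hN₂) ⟨?_, ?_⟩
  · rintro ⟨-, h⟩
    simpa [commanded, polled] using (hI₂.eq_true output).1 h
  · convert represents_map_floor hI₂ (by simp [commanded, polled]) hN₂ with d
    rw [hxs' d, hv]

theorem inert_or_mem_frames (hS : ∀ o, command c o ∉ S) {T : Thread} {l : List ℕ}
    (hT : T ∈ counterListening g c l) : Inert g S T ∨ T ∈ frames g c l := by
  simp only [counterListening, Multiset.mem_add, Multiset.mem_singleton] at hT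
  obtain rfl | rfl | rfl | hT := hT
  · exact .inl (inert_branch (hS _) _)
  · exact .inl (inert_branch (hS _) _)
  · exact .inl (inert_branch (hS _) _)
  · exact .inr hT

theorem final_of_inert_or_mem_frames (hI : Inv J g S E (xs 0 ++ xs 1)) (hclock : clock ∈ S)
    (hP : ∀ T ∈ P, Inert g S T ∨ ∃ c, T ∈ frames g c (xs c)) :
    Final D (P, E) ∧ Dead J (P.map (Thread.floor E)) := by
  have hsub (c : Fin 2) : xs c ⊆ xs 0 ++ xs 1 := by
    fin_cases c
    exacts [List.subset_append_left _ _, List.subset_append_right _ _]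
  refine ⟨fun T h => ?_, fun T h => ?_⟩
  · obtain hT | ⟨c, hT⟩ := hP T h
    · exact hT.suspended hI
    · exact suspended_of_mem_frames hT hI (hsub c)
  · obtain ⟨U, hUP, rfl⟩ := Multiset.mem_map.1 h
    obtain hU | ⟨c, hU⟩ := hP U hUP
    · exact .inl (hU.floor_eq_nil ((hI.eq_true clock).2 hclock))
    · obtain ⟨x, hx, V, rfl⟩ := mem_frames hU
      exact .inr ⟨x, fun h => hI.notMem (hsub c hx) (.inl h), V, rfl⟩

theorem Represents.everyInstant_of_eq_none (hg : Wiring J g)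
    (hD : ∀ c : Fin 2, D[(c : ℕ)]? = some (counterEq c)) (hi : D[i]? = some (controlEq c a))
    (ha : a (decide (v c = 0)) = none) (hP : Represents J g i v P) :
    EveryInstant J D P fun O P' => g output ∈ O ∧ Dead J P' := by
  obtain ⟨xs, N, rfl, hv, hN, hnodup, hxs⟩ := hP
  have hb : (xs c).isEmpty = decide (v c = 0) := by
    rw [← hv]
    cases xs c <;> simp
  refine .of_settles fun I hI => settles_stateThreads hg.injective hD hi hN
    (inv_startEnv hg hI hnodup hxs) fun E₁ N₁ hI₁ hN₁ => ?_
  rw [hb, ha]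
  refine .emit (.emit (g output)) (hI₁.ne_none (mem_publicSigs _)) ?_
  have hcmd {d : Fin 2} (o : Op) : command d o ∉ insert output (polled xs) := by simp [polled]
  have hsub : insert output (polled xs) ⊆ {p | p ≠ status c !(xs c).isEmpty} :=
    Set.insert_subset (by simp) polled_subset
  obtain ⟨hfinal, hdead⟩ := final_of_inert_or_mem_frames (D := D)
    (P := {.nil} + (counterListening g 0 (xs 0) + (counterListening g 1 (xs 1) + N₁)))
    (hI₁.emit hg.injective output) (.inr (.inl rfl)) (by
      simp only [Multiset.mem_add, Multiset.mem_singleton]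
      rintro T (rfl | hT | hT | hT)
      · exact .inl (.inl rfl)
      · exact (inert_or_mem_frames hcmd hT).imp_right fun h => ⟨0, h⟩
      · exact (inert_or_mem_frames hcmd hT).imp_right fun h => ⟨1, h⟩
      · exact .inl ((hN₁ T hT).anti hsub))
  exact .of_final hfinal ⟨⟨hg.output_mem, Function.update_self ..⟩, hdead⟩

theorem Dead.everyInstant (hP : Dead J P) : EveryInstant J D P fun _ P' => Dead J P' := by
  refine .of_settles fun I hI => .of_final (fun T hT => ?_) fun T hT => ?_
  · obtain rfl | ⟨x, hx, U, rfl⟩ := hP T hT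
    · exact suspended_nil
    · exact Thread.Blocked.suspended (T := .seq (.await (.sig x)) U) (startEnv_ne_true hI hx)
  · obtain ⟨V, hV, rfl⟩ := Multiset.mem_map.1 hT
    obtain rfl | ⟨x, hx, U, rfl⟩ := hP V hV
    · exact .inl rfl
    · exact .inr ⟨x, hx, U, rfl⟩

end Program

end SL

namespace CounterMachine

open SL

/-- The counter on which an instruction operates. -/
def Instr.counter : Instr → Fin 2
  | .inc c _ | .dec c _ | .test c _ _ => c

/-- The operation on its counter and the next state, given whether the counter is zero. -/
def Instr.action : Instr → Bool → Option (Op × ℕ)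
  | .inc _ q, _ => some (.inc, q)
  | .dec _ _, true => none
  | .dec _ q, false => some (.dec, q)
  | .test _ q _, true => some (.keep, q)
  | .test _ _ q', false => some (.keep, q')

theorem Instr.eq_false_of_action_eq_dec {i : Instr} {b : Bool} {q : ℕ}
    (h : i.action b = some (.dec, q)) : b = false := by
  cases i <;> cases b <;> simp_all [action]

theorem Instr.exec_eq (i : Instr) (v : Fin 2 → ℕ) :
    i.exec v = (i.action (decide (v i.counter = 0))).map fun a =>
      ⟨a.2, fun c => (commands i.counter a.1 c).apply (v c)⟩ := by
  have happly (c : Fin 2) (o : Op) :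
      (fun d => (commands c o d).apply (v d)) = Function.update v c (o.apply (v c)) := by
    ext d
    obtain rfl | hd := eq_or_ne d c
    · simp [commands]
    · simp [commands, hd, Op.apply]
  simp only [happly]
  cases i with
  | inc c q => rfl
  | dec c q => by_cases hc : v c = 0 <;> simp [exec, action, counter, hc, Op.apply]
  | test c q q' => by_cases hc : v c = 0 <;> simp [exec, action, counter, hc, Op.apply]

end CounterMachine

namespace SL

open CounterMachine Op Port

/-! ### The program of a machine -/

/-- The identifier of the control thread in the state `q` of a machine with `n` instructions; all
states without instruction share one identifier. -/
def stateId (n q : ℕ) : ℕ := if q < n then q + 3 else 2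

/-- The equation of a state with the given instruction, if any; the machine has `n` instructions. -/
def stateEq (n : ℕ) : Option Instr → Equation
  | none => controlEq 0 fun _ => none
  | some i => controlEq i.counter fun b => (i.action b).map (Prod.map id (stateId n))

/-- The equations of the two counters, of the states without instruction, and of the other states,
in the order expected by `stateId` and `counterCall`. -/
def machineEqs (code : List Instr) : List Equation :=
  counterEq 0 :: counterEq 1 :: stateEq code.length none ::
    code.map fun i => stateEq code.length (some i)

theorem machineEqs_counter (code : List Instr) (c : Fin 2) :
    (machineEqs code)[(c : ℕ)]? = some (counterEq c) := by
  fin_cases c <;> rfl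

theorem machineEqs_stateId (code : List Instr) (q : ℕ) :
    (machineEqs code)[stateId code.length q]? = some (stateEq code.length code[q]?) := by
  unfold stateId machineEqs
  split_ifs with h
  · simp [h]
  · rw [List.getElem?_eq_none (not_lt.1 h)]
    rfl

/-- The programs that represent a configuration, or remain after halting. -/
def Encodes (J : Interface) (g : Port → ℕ) (code : List Instr) :
    Option Config → Multiset Thread → Prop
  | some k, P => Represents J g (stateId code.length k.state) k.cnt P
  | none, P => Dead J P

theorem Represents.everyInstant {J : Interface} {g : Port → ℕ} (hg : Wiring J g) (M : Machine)
    {k : Config} {P : Multiset Thread}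
    (hP : Represents J g (stateId M.code.length k.state) k.cnt P) :
    EveryInstant J (machineEqs M.code) P fun O P' =>
      (g output ∈ O ↔ M.next k = none) ∧ Encodes J g M.code (M.next k) P' := by
  have hq := machineEqs_stateId M.code k.state
  have hD := machineEqs_counter M.code
  unfold Machine.next
  cases hi : M.code[k.state]? with
  | none =>
    rw [hi] at hq
    simpa [Encodes] using hP.everyInstant_of_eq_none hg hD hq rfl
  | some i =>
    rw [hi] at hq
    simp only [i.exec_eq]
    cases ha : i.action (decide (k.cnt i.counter = 0)) with
    | none =>
      simpa [Encodes] using hP.everyInstant_of_eq_none hg hD hq (by simp only [ha, Option.map_none])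
    | some a =>
      obtain ⟨o, q⟩ := a
      have hdec : o = dec → k.cnt i.counter ≠ 0 := by
        rintro rfl
        exact of_decide_eq_false (Instr.eq_false_of_action_eq_dec ha)
      simpa [Encodes] using hP.everyInstant_of_eq_some hg hD hq
        (by simp only [ha, Option.map_some]; rfl) hdec

theorem simulation_machineEqs {J : Interface} {g : Port → ℕ} (hg : Wiring J g) (M : Machine) :
    Simulation J (machineEqs M.code) M.next (g output) (Encodes J g M.code) where
  active hP := Represents.everyInstant hg M hP
  halted hP := Dead.everyInstant hP

/-- The program of a machine whose counters are initially zero: the control thread and two counters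
without frames. -/
def machineProgram (g : Port → ℕ) (M : Machine) : Program :=
  ⟨machineEqs M.code, [.seq .nil (controlCall (portSig g) (stateId M.code.length M.start)),
    .seq .nil (stackCall g 0 []), .seq .nil (stackCall g 1 [])]⟩

theorem encodes_machineProgram (J : Interface) (g : Port → ℕ) {M : Machine} (hM : M.init = 0) :
    Encodes J g M.code (some M.initial) (machineProgram g M).threads := by
  refine ⟨fun _ => [], 0, ?_, fun c => by simp [Machine.initial, hM], by simp, by simp, by simp⟩
  rfl

theorem Name.Closed.lift {x : Name} {k : ℕ} (h : x.Closed k) : x.lift.Closed (k + 1) := by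
  cases x with
  | sig s => trivial
  | var i => exact Nat.succ_lt_succ h

section WellFormed

variable {D : List Equation} {nm : Port → Name} {c : Fin 2} {st x y : Name} {k : ℕ}

theorem counterCall_wf (hD : D[(c : ℕ)]? = some (counterEq c)) (hnm : ∀ p, (nm p).Closed k)
    (hst : st.Closed k) (hx : x.Closed k) : (counterCall nm c st x).WF D k := by
  refine ⟨⟨_, hD, by simp [counterEq]⟩, ?_⟩
  simpa [or_imp, forall_and, hst, hx] using fun p _ => hnm p

theorem push_wf (hD : D[(c : ℕ)]? = some (counterEq c)) (hnm : ∀ p, (nm p).Closed k)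
    (hst : st.Closed k) (hx : x.Closed k) (hy : y.Closed k) : (push nm c st x y).WF D k :=
  ⟨⟨hy, ⟨hnm _, hnm _⟩, counterCall_wf hD hnm hst hx⟩, ⟨hnm _, hnm _⟩,
    counterCall_wf hD hnm (hnm _) hy⟩

theorem counterBody_wf (hD : D[(c : ℕ)]? = some (counterEq c)) (hnm : ∀ p, (nm p).Closed k)
    (hst : st.Closed k) (hx : x.Closed k) : (counterBody nm c st x).WF D k :=
  ⟨hst,
    ⟨hnm _, hnm _, push_wf hD (fun p => (hnm p).lift) hst.lift hx.lift (Nat.succ_pos k)⟩,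
    ⟨hnm _, hnm _, hx⟩,
    ⟨hnm _, hnm _, ⟨hnm _, hnm _⟩, counterCall_wf hD hnm hst hx⟩⟩

theorem sigs_counterCall (hnm : ∀ p, (nm p).sigs = ∅) (hst : st.sigs = ∅) (hx : x.sigs = ∅) :
    (counterCall nm c st x).sigs = ∅ := by
  simp [counterCall, Thread.sigs, Set.eq_empty_iff_forall_notMem, or_imp, forall_and, hst, hx, hnm]

theorem Name.sigs_lift (x : Name) : x.lift.sigs = x.sigs := by
  cases x <;> rfl

theorem sigs_counterBody (hnm : ∀ p, (nm p).sigs = ∅) (hst : st.sigs = ∅) (hx : x.sigs = ∅) :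
    (counterBody nm c st x).sigs = ∅ := by
  have hvar (i : ℕ) : (Name.var i).sigs = ∅ := rfl
  simp [counterBody, obey, push, pause, branch, Thread.sigs, sigs_counterCall, Name.sigs_lift,
    hvar, hnm, hst, hx]

theorem counterEq_wf (hD : D[(c : ℕ)]? = some (counterEq c)) :
    (counterEq c).body.WF D (counterEq c).arity ∧ (counterEq c).body.sigs = ∅ := by
  constructor
  · exact counterBody_wf hD (fun p => p.index_lt.trans (by simp [counterEq]))
      (Nat.lt_succ_of_lt (Nat.lt_succ_self _)) (Nat.lt_succ_self _)
  · exact sigs_counterBody (fun _ => rfl) rfl rfl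

theorem controlEq_wf {a : Bool → Option (Op × ℕ)}
    (h : ∀ b o i, a b = some (o, i) → ∃ e, D[i]? = some e ∧ e.arity = ports.length) :
    (controlEq c a).body.WF D (controlEq c a).arity ∧ (controlEq c a).body.sigs = ∅ := by
  have hreply (b : Bool) : (reply portVar c (a b)).WF D ports.length ∧
      (reply portVar c (a b)).sigs = ∅ := by
    cases hb : a b with
    | none => simp [reply, portVar, Thread.WF, Name.Closed, Thread.sigs, Name.sigs, Port.index_lt]
    | some x =>
      obtain ⟨o, i⟩ := x
      simp [reply, pause, controlCall, portVar, Thread.WF, Name.Closed, Thread.sigs, Name.sigs,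
        Port.index_lt, h b o i hb]
  simp [controlEq, controlBody, branch, portVar, Thread.WF, Name.Closed, Thread.sigs, Name.sigs,
    Port.index_lt, hreply]

end WellFormed

theorem stateEq_arity (n : ℕ) (i : Option Instr) : (stateEq n i).arity = ports.length := by
  cases i <;> rfl

theorem stateEq_wf (code : List Instr) (i : Option Instr) :
    (stateEq code.length i).body.WF (machineEqs code) (stateEq code.length i).arity ∧
      (stateEq code.length i).body.sigs = ∅ := by
  cases i with
  | none => exact controlEq_wf nofun
  | some i =>
    refine controlEq_wf fun b o j h => ?_
    obtain ⟨⟨_, q⟩, -, h⟩ := Option.map_eq_some_iff.1 h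
    obtain ⟨-, rfl⟩ := Prod.mk.inj h
    exact ⟨_, machineEqs_stateId code q, stateEq_arity _ _⟩

theorem machineProgram_wf (g : Port → ℕ) (M : Machine) : (machineProgram g M).WF := by
  refine ⟨by simp [machineProgram], ?_, ?_⟩
  · have hcounter (c : Fin 2) : (stackCall g c []).WF (machineEqs M.code) 0 :=
      counterCall_wf (machineEqs_counter M.code c) (fun _ => trivial) trivial trivial
    have hcontrol : (controlCall (portSig g) (stateId M.code.length M.start)).WF
        (machineEqs M.code) 0 :=
      ⟨⟨_, machineEqs_stateId M.code M.start, by simp [stateEq_arity]⟩,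
        by simp [portSig, Name.Closed]⟩
    simp [machineProgram, Thread.WF, hcounter, hcontrol]
  · simp only [machineProgram, machineEqs, List.forall_mem_cons, List.forall_mem_map]
    exact ⟨counterEq_wf (machineEqs_counter M.code 0), counterEq_wf (machineEqs_counter M.code 1),
      stateEq_wf _ _, fun i _ => stateEq_wf _ _⟩

end SL

namespace CounterMachine

/-! ### Machines that start with empty counters -/

theorem Machine.terminates_iff (M : Machine) :
    M.Terminates ↔ (StateTransition.eval M.next M.initial).Dom := by
  simp only [Part.dom_iff_mem, StateTransition.mem_eval]
  rfl

/-- The instruction with its target states renumbered to make room for a new state `0`. -/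
def Instr.shift : Instr → Instr
  | .inc c q => .inc c (q + 1)
  | .dec c q => .dec c (q + 1)
  | .test c q q' => .test c (q + 1) (q' + 1)

/-- The configuration with its state renumbered to make room for a new state `0`. -/
def Config.shift (k : Config) : Config := ⟨k.state + 1, k.cnt⟩

theorem Instr.exec_shift (i : Instr) (v : Fin 2 → ℕ) :
    i.shift.exec v = (i.exec v).map Config.shift := by
  cases i with
  | inc c q => rfl
  | dec c q => by_cases h : v c = 0 <;> simp [shift, exec, Config.shift, h]
  | test c q q' => by_cases h : v c = 0 <;> simp [shift, exec, Config.shift, h]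

/-- The machine `M` preceded by an increment of the counter `c`. -/
def Machine.prependInc (c : Fin 2) (M : Machine) : Machine :=
  ⟨.inc c (M.start + 1) :: M.code.map Instr.shift, 0, M.init⟩

theorem Machine.next_prependInc_shift (c : Fin 2) (M : Machine) (k : Config) :
    (M.prependInc c).next k.shift = (M.next k).map Config.shift := by
  simp only [next, prependInc, Config.shift, List.getElem?_cons_succ, List.getElem?_map]
  cases M.code[k.state]? with
  | none => rfl
  | some i => exact i.exec_shift k.cnt

theorem Machine.prependInc_terminates (c : Fin 2) (M : Machine) :
    (M.prependInc c).Terminates ↔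
      ({M with init := Function.update M.init c (M.init c + 1)} : Machine).Terminates := by
  set N : Machine := {M with init := Function.update M.init c (M.init c + 1)}
  have hstart : (M.prependInc c).next (M.prependInc c).initial = some N.initial.shift := rfl
  have hrespects : StateTransition.Respects N.next (M.prependInc c).next
      fun k l => k.shift = l := by
    refine StateTransition.fun_respects.2 fun k => ?_
    have hnext : (M.prependInc c).next k.shift = (N.next k).map Config.shift :=
      M.next_prependInc_shift c k
    cases hk : N.next k with
    | none => exact hnext.trans (by rw [hk, Option.map_none])
    | some l => exact .single (by simp [hnext, hk])
  rw [terminates_iff, terminates_iff, StateTransition.reaches_eval (.single hstart),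
    StateTransition.tr_eval_dom hrespects rfl]

theorem Machine.iterate_prependInc_terminates (c : Fin 2) (n : ℕ) (M : Machine)
    (v : Fin 2 → ℕ) :
    ({(prependInc c)^[n] M with init := v} : Machine).Terminates ↔
      ({M with init := Function.update v c (v c + n)} : Machine).Terminates := by
  induction n generalizing M with
  | zero => simp
  | succ n ih =>
    rw [Function.iterate_succ_apply, ih]
    change (prependInc c {M with init := Function.update v c (v c + n)}).Terminates ↔ _
    rw [prependInc_terminates]
    simp only [Function.update_self, Function.update_idem, Nat.add_assoc]

/-- A machine that starts with empty counters and first fills them with the initial contents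
of `M`. -/
def Machine.zeroInit (M : Machine) : Machine :=
  {(prependInc 1)^[M.init 1] ((prependInc 0)^[M.init 0] M) with init := 0}

theorem Machine.zeroInit_terminates (M : Machine) : M.zeroInit.Terminates ↔ M.Terminates := by
  have hfill :
      Function.update (Function.update (0 : Fin 2 → ℕ) 1 (M.init 1)) 0 (M.init 0) = M.init := by
    ext c
    fin_cases c <;> simp
  simp [zeroInit, iterate_prependInc_terminates, hfill]

/-! ### Computability of the encoding -/

theorem primrec_of_instr_cases {σ : Type*} [Primcodable σ] {f : Instr → σ}
    (hinc : Primrec fun x : Fin 2 × ℕ => f (.inc x.1 x.2))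
    (hdec : Primrec fun x : Fin 2 × ℕ => f (.dec x.1 x.2))
    (htest : Primrec fun x : Fin 2 × ℕ × ℕ => f (.test x.1 x.2.1 x.2.2)) : Primrec f := by
  refine (Primrec.sumCasesOn (Primrec.of_equiv (e := Instr.equivSum)) (hinc.comp Primrec.snd).to₂
    (Primrec.sumCasesOn Primrec.snd (hdec.comp Primrec.snd).to₂
      (htest.comp Primrec.snd).to₂).to₂).of_eq fun i => ?_
  cases i <;> rfl

theorem primrec_inc : Primrec₂ Instr.inc :=
  (Primrec.of_equiv_symm (e := Instr.equivSum)).comp Primrec.sumInl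

theorem primrec_dec : Primrec₂ Instr.dec :=
  (Primrec.of_equiv_symm (e := Instr.equivSum)).comp (Primrec.sumInr.comp Primrec.sumInl)

theorem primrec_test : Primrec fun x : Fin 2 × ℕ × ℕ => Instr.test x.1 x.2.1 x.2.2 :=
  (Primrec.of_equiv_symm (e := Instr.equivSum)).comp (Primrec.sumInr.comp Primrec.sumInr)

theorem primrec_counter : Primrec Instr.counter :=
  primrec_of_instr_cases Primrec.fst Primrec.fst Primrec.fst

theorem primrec_shift : Primrec Instr.shift :=
  primrec_of_instr_cases
    (primrec_inc.comp Primrec.fst (Primrec.succ.comp Primrec.snd))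
    (primrec_dec.comp Primrec.fst (Primrec.succ.comp Primrec.snd))
    (primrec_test.comp (Primrec.fst.pair ((Primrec.succ.comp (Primrec.fst.comp Primrec.snd)).pair
      (Primrec.succ.comp (Primrec.snd.comp Primrec.snd)))))

theorem primrec_code : Primrec Machine.code :=
  Primrec.fst.comp (Primrec.of_equiv (e := Machine.equivProd))

theorem primrec_start : Primrec Machine.start :=
  (Primrec.fst.comp Primrec.snd).comp (Primrec.of_equiv (e := Machine.equivProd))

theorem primrec_init : Primrec Machine.init :=
  (Primrec.snd.comp Primrec.snd).comp (Primrec.of_equiv (e := Machine.equivProd))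

theorem primrec_machine {α : Type*} [Primcodable α] {code : α → List Instr} {start : α → ℕ}
    {init : α → Fin 2 → ℕ} (hcode : Primrec code) (hstart : Primrec start) (hinit : Primrec init) :
    Primrec fun a => Machine.mk (code a) (start a) (init a) :=
  (Primrec.of_equiv_symm (e := Machine.equivProd)).comp (hcode.pair (hstart.pair hinit))

theorem primrec_prependInc (c : Fin 2) : Primrec (Machine.prependInc c) :=
  primrec_machine
    (Primrec.list_cons.comp
      (primrec_inc.comp (Primrec.const c) (Primrec.succ.comp primrec_start))
      (Primrec.list_map primrec_code (primrec_shift.comp Primrec.snd).to₂))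
    (Primrec.const 0) primrec_init

theorem primrec_zeroInit : Primrec Machine.zeroInit := by
  have hinit (c : Fin 2) : Primrec fun M : Machine => M.init c :=
    Primrec.fin_app.comp primrec_init (Primrec.const c)
  have hprepend (c : Fin 2) {f : Machine → Machine} (hf : Primrec f) :
      Primrec fun M => (Machine.prependInc c)^[M.init c] (f M) :=
    Primrec.nat_iterate (hinit c) hf ((primrec_prependInc c).comp Primrec.snd).to₂
  have hfill := hprepend 1 (hprepend 0 Primrec.id)
  exact primrec_machine (primrec_code.comp hfill) (primrec_start.comp hfill) (Primrec.const 0)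

end CounterMachine

namespace SL

open CounterMachine

/-- Operations are coded as the elements of a three-element type. -/
def Op.equivFin : Op ≃ Fin 3 where
  toFun
    | .inc => 0
    | .dec => 1
    | .keep => 2
  invFun := ![.inc, .dec, .keep]
  left_inv o := by cases o <;> rfl
  right_inv i := by fin_cases i <;> rfl

instance : Primcodable Op := Primcodable.ofEquiv _ Op.equivFin

instance : Finite Op := .of_equiv _ Op.equivFin.symm

theorem primrec_seq : Primrec₂ Thread.seq := by
  refine Primrec₂.encode_iff.1 ?_
  change Primrec₂ fun T T' : Thread => 7 * Nat.pair (Encodable.encode T) (Encodable.encode T') + 1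
  exact Primrec.succ.comp (Primrec.nat_mul.comp (Primrec.const 7)
    (Primrec₂.natPair.comp (Primrec.encode.comp Primrec.fst) (Primrec.encode.comp Primrec.snd)))

theorem primrec_thread : Primrec Thread.thread := by
  refine Primrec.encode_iff.1 ?_
  change Primrec fun T : Thread => 7 * Encodable.encode T + 4
  exact Primrec.nat_add.comp (Primrec.nat_mul.comp (Primrec.const 7) Primrec.encode)
    (Primrec.const 4)

theorem primrec_watch (x : Name) : Primrec (Thread.watch x) := by
  refine Primrec.encode_iff.1 ?_
  change Primrec fun T : Thread => 7 * Nat.pair (Encodable.encode x) (Encodable.encode T) + 6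
  exact Primrec.nat_add.comp (Primrec.nat_mul.comp (Primrec.const 7)
    (Primrec₂.natPair.comp (Primrec.const _) Primrec.encode)) (Primrec.const 6)

theorem primrec_call (xs : List Name) : Primrec fun i => Thread.call i xs := by
  refine Primrec.encode_iff.1 ?_
  change Primrec fun i => 7 * Nat.pair i (Encodable.encode xs) + 7
  exact Primrec.nat_add.comp (Primrec.nat_mul.comp (Primrec.const 7)
    (Primrec₂.natPair.comp Primrec.id (Primrec.const _))) (Primrec.const 7)

theorem primrec_equation (n : ℕ) : Primrec (Equation.mk n) :=
  (Primrec.of_equiv_symm (e := Equation.equivProd)).comp ((Primrec.const n).pair Primrec.id)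

theorem primrec_program : Primrec₂ Program.mk :=
  Primrec.of_equiv_symm (e := Program.equivProd)

theorem primrec_reply (nm : Port → Name) : Primrec₂ (reply nm) := by
  have hemit (d : Fin 2) : Primrec fun x : (Fin 2 × Option (Op × ℕ)) × Op × ℕ =>
      Thread.emit (nm (.command d (commands x.1.1 x.2.1 d))) :=
    (Primrec.dom_finite fun y : Fin 2 × Op =>
      Thread.emit (nm (.command d (commands y.1 y.2 d)))).comp
        ((Primrec.fst.comp Primrec.fst).pair (Primrec.fst.comp Primrec.snd))
  have hcall : Primrec fun x : (Fin 2 × Option (Op × ℕ)) × Op × ℕ => controlCall nm x.2.2 :=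
    (primrec_call _).comp (Primrec.snd.comp Primrec.snd)
  refine (Primrec.option_casesOn Primrec.snd (Primrec.const (.emit (nm .output)))
    (primrec_seq.comp (hemit 0) (primrec_seq.comp (hemit 1)
      (primrec_seq.comp (Primrec.const (pause nm)) hcall))).to₂).of_eq fun x => ?_
  obtain ⟨c, _ | ⟨o, i⟩⟩ := x <;> rfl

theorem primrec_controlEq {α : Type*} [Primcodable α] {c : α → Fin 2}
    {a : α → Bool → Option (Op × ℕ)} (hc : Primrec c) (ha : ∀ b, Primrec fun x => a x b) :
    Primrec fun x => controlEq (c x) (a x) := by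
  have hbranch (b : Bool) : Primrec fun x => branch portVar (.status (c x) b)
      (.thread (reply portVar (c x) (a x b))) :=
    (primrec_watch _).comp (primrec_seq.comp
      ((Primrec.dom_finite fun d : Fin 2 => Thread.await (portVar (.status d b))).comp hc)
      (primrec_thread.comp ((primrec_reply _).comp hc (ha b))))
  exact (primrec_equation _).comp (primrec_seq.comp (Primrec.const _)
    (primrec_seq.comp (primrec_thread.comp (hbranch true)) (hbranch false)))

theorem primrec_action (b : Bool) : Primrec fun i : Instr => i.action b := by
  have haction {β : Type} [Primcodable β] (o : Op) {q : β → ℕ} (hq : Primrec q) :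
      Primrec fun x => some (o, q x) :=
    Primrec.option_some.comp ((Primrec.const o).pair hq)
  have hinc := haction .inc (Primrec.snd (α := Fin 2) (β := ℕ))
  cases b with
  | true =>
    exact primrec_of_instr_cases hinc (Primrec.const none)
      (haction .keep (Primrec.fst.comp Primrec.snd))
  | false =>
    exact primrec_of_instr_cases hinc (haction .dec Primrec.snd)
      (haction .keep (Primrec.snd.comp Primrec.snd))

theorem primrec_stateId : Primrec₂ stateId :=
  Primrec.ite (Primrec.nat_lt.comp Primrec.snd Primrec.fst)
    (Primrec.nat_add.comp Primrec.snd (Primrec.const 3)) (Primrec.const 2)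

theorem primrec_stateEq_some : Primrec₂ fun (n : ℕ) (i : Instr) => stateEq n (some i) := by
  refine primrec_controlEq (primrec_counter.comp Primrec.snd) fun b => ?_
  exact Primrec.option_map ((primrec_action b).comp Primrec.snd)
    ((Primrec.fst.comp Primrec.snd).pair (primrec_stateId.comp (Primrec.fst.comp Primrec.fst)
      (Primrec.snd.comp Primrec.snd))).to₂

theorem primrec_machineEqs : Primrec machineEqs := by
  have hhalt : Primrec fun n => stateEq n none := Primrec.const (controlEq 0 fun _ => none)
  exact Primrec.list_cons.comp (Primrec.const _) <| Primrec.list_cons.comp (Primrec.const _) <|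
    Primrec.list_cons.comp (hhalt.comp Primrec.list_length) <|
    Primrec.list_map Primrec.id
      (primrec_stateEq_some.comp (Primrec.list_length.comp Primrec.fst) Primrec.snd).to₂

theorem primrec_machineProgram (g : Port → ℕ) : Primrec (machineProgram g) := by
  have hstart : Primrec fun M : Machine => stateId M.code.length M.start :=
    primrec_stateId.comp (Primrec.list_length.comp primrec_code) primrec_start
  exact primrec_program.comp (primrec_machineEqs.comp primrec_code)
    (Primrec.list_cons.comp
      (primrec_seq.comp (Primrec.const _) ((primrec_call _).comp hstart)) (Primrec.const _))

theorem exists_wiring (J : Interface) {out : ℕ} (hout : out ∈ J.output) (hin : out ∉ J.input) :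
    ∃ g : Port → ℕ, Wiring J g ∧ g .output = out := by
  classical
  let hidden : Port → ℕ := fun p => J.infinite_compl.natEmbedding _ p.index
  have hhidden (p : Port) : hidden p ∉ J.input ∪ J.output :=
    (J.infinite_compl.natEmbedding _ p.index).2
  have hinj : Function.Injective hidden :=
    Subtype.val_injective.comp <| (J.infinite_compl.natEmbedding _).injective.comp
      Port.index_injective
  have hne (p : Port) : hidden p ≠ out := fun h => hhidden p (.inr (h ▸ hout))
  refine ⟨Function.update hidden .output out, ⟨?_, fun p => ?_, by simpa using hout⟩, by simp⟩
  · intro p q h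
    by_cases hp : p = .output <;> by_cases hq : q = .output <;>
      simp_all [hinj.eq_iff, (hne _).symm]
  · obtain rfl | hp := eq_or_ne p .output
    · simpa using hin
    · simpa [hp] using fun h => hhidden p (.inl h)

end SL

theorem mainTheorem8 (J : SL.Interface) (out : ℕ) (hout : out ∈ J.output)
    (hin : out ∉ J.input) :
    ∃ compile : CounterMachine.Machine → SL.Program, Computable compile ∧
      ∀ M : CounterMachine.Machine,
        (compile M).WF ∧
        SL.Reactive J (compile M).eqs ((compile M).threads : Multiset SL.Thread) ∧
        (SL.MustEmit J (compile M).eqs ((compile M).threads : Multiset SL.Thread) out ↔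
          M.Terminates) ∧
        (SL.MayEmit J (compile M).eqs ((compile M).threads : Multiset SL.Thread) out ↔
          M.Terminates) := by
  obtain ⟨g, hg, rfl⟩ := SL.exists_wiring J hout hin
  refine ⟨fun M => SL.machineProgram g M.zeroInit,
    ((SL.primrec_machineProgram g).comp CounterMachine.primrec_zeroInit).to_comp, fun M => ?_⟩
  have hsim := SL.simulation_machineEqs hg M.zeroInit
  have hrep := SL.encodes_machineProgram J g (M := M.zeroInit) rfl
  rw [← M.zeroInit_terminates, CounterMachine.Machine.terminates_iff]
  exact ⟨SL.machineProgram_wf g _, hsim.reactive hrep, hsim.mustEmit_iff hrep,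
    hsim.mayEmit_iff hrep⟩
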